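/- \textbf{Growth constant for every fixed adjacency bound.} For integers $m\ge 1$, $n\ge 0$ let $a_n^{(m)}$ be the number of permutations $\pi$ of $\{1,\dots,n\}$ that avoid the pattern $132$ (there are no $i<j<k$ with $\pi_i<\pi_k<\pi_j$) and satisfy $|\pi_{i+1}-\pi_i|\le m$ for all $1\le i<n$, so $a_0^{(m)}=1$, and let $A^{(m)}(x)=\sum_{n\ge0}a_n^{(m)}x^n$. Let $B_m=\{0,1,\dots,m-1,\infty\}$, with $\infty-r=\infty$. For $1\le k\le m$ and $p\in B_m$ put $c_{1,p}=1$, and for $k\ge2$ let $c_{k,p}$ be the number of $132$-avoiding permutations $\sigma$ of $\{1,\dots,k-1\}$ with $k-\sigma_1\le p$. Let $W_m(x)$ be the polynomial matrix with rows and columns indexed by $B_m^2$ and entries \[ W_{(p,q),(r,s)}^{(m)}(x)=\sum_{k=1}^{m}c_{k,p}\,x^k\,[(r,s)=(m-k,q-k)]+x\,[(r,s)=(p-1,m-1)], \] where $[E]$ is $1$ if $E$ holds and $0$ otherwise. For $S\subseteq B_m^2$ let $W_S(x)$ be the principal submatrix of $W_m(x)$ indexed by $S$. Let \[ U_m=\{(p,\infty):0\le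 p\le m-1\},\qquad V_m=\{(p,q):0\le q<p\le m-1\}\cup\{(p,m-1):0\le p\le m-2\}. \] The component radius $r_C$ of $C\in\{U_m,V_m\}$ is the unique $x>0$ at which the spectral radius of $W_C(x)$ equals $1$. For $m=1$, $\lim_{n\to\infty}(a_n^{(1)})^{1/n}=1$. For every $m\ge2$, the component radii $r_{U_m},r_{V_m}$ exist, are unique, and lie in $(0,1]$. Put $\lambda_U(m)=r_{U_m}^{-1}$, $\lambda_V(m)=r_{V_m}^{-1}$ and $\rho_m=\min\{r_{U_m},r_{V_m}\}$. Then the limit of $(a_n^{(m)})^{1/n}$ as $n\to\infty$ exists and \[ \lim_{n\to\infty}(a_n^{(m)})^{1/n}=\max\{\lambda_U(m),\lambda_V(m)\}=\rho_m^{-1}. \] The radius of convergence of $A^{(m)}$ is $\rho_m$. Moreover $A^{(m)}$ is a rational function, and $x=\rho_m$ is its unique dominant pole, that is, its unique complex pole whose modulus equals the radius of convergence. -/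

import Mathlib

open Polynomial

namespace BoundedAvoid

/-- The permutation `π` of `{0, …, n-1}` avoids the pattern 132. -/
def Avoids132 {n : ℕ} (π : Equiv.Perm (Fin n)) : Prop :=
  ¬ ∃ i j k : Fin n, i < j ∧ j < k ∧ π i < π k ∧ π k < π j

/-- Consecutive entries of `π` differ by at most `m`. -/
def IsBounded (m : ℕ) {n : ℕ} (π : Equiv.Perm (Fin n)) : Prop :=
  ∀ i j : Fin n, (i : ℕ) + 1 = j → |((π j : ℕ) : ℤ) - ((π i : ℕ) : ℤ)| ≤ m

open Classical in
/-- The set of `m`-bounded 132-avoiding permutations of length `n`. -/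
noncomputable def avoiders (m n : ℕ) : Finset (Equiv.Perm (Fin n)) :=
  Finset.univ.filter fun π => Avoids132 π ∧ IsBounded m π

/-- The number of `m`-bounded 132-avoiding permutations of length `n`. -/
noncomputable def count (m n : ℕ) : ℕ := (avoiders m n).card

/-- The ordinary generating function of the numbers `count m n`. -/
noncomputable def genFun (m : ℕ) : PowerSeries ℂ :=
  PowerSeries.mk fun n => (count m n : ℂ)

/-- The radius of convergence of a complex power series in one variable. -/
noncomputable def radius (f : PowerSeries ℂ) : ENNReal :=
  (FormalMultilinearSeries.ofScalars ℂ (fun n => PowerSeries.coeff n f)).radius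

/-- `z` is a pole of the rational function whose expansion at `0` is `f`: a root of the
denominator of a reduced fraction `N / D` that represents `f`. -/
def IsPole (f : PowerSeries ℂ) (z : ℂ) : Prop :=
  ∃ N D : ℂ[X], IsCoprime N D ∧ (D : PowerSeries ℂ) * f = (N : PowerSeries ℂ) ∧ D.IsRoot z

/-- A dominant pole is a pole whose modulus is the radius of convergence. -/
def IsDominantPole (f : PowerSeries ℂ) (z : ℂ) : Prop :=
  IsPole f z ∧ ENNReal.ofReal ‖z‖ = radius f

/-- The thresholds `0, 1, …, m - 1, ∞`. -/
abbrev Threshold (m : ℕ) : Type := WithTop (Fin m)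

/-- The endpoint states: pairs of thresholds. -/
abbrev State (m : ℕ) : Type := Threshold m × Threshold m

/-- A threshold as an element of `ℤ ∪ {∞}`. -/
def Threshold.val {m : ℕ} (p : Threshold m) : WithTop ℤ :=
  WithTop.map (fun i : Fin m => ((i : ℕ) : ℤ)) p

/-- The shift `u ↦ u - k` on `ℤ ∪ {∞}`, with `∞ - k = ∞`. -/
def shift (u : WithTop ℤ) (k : ℕ) : WithTop ℤ :=
  WithTop.map (fun z : ℤ => z - (k : ℤ)) u

open Classical in
/-- The left-block coefficient `c_{k,p}`: it is `1` for `k = 1`, and for `k ≥ 2` it is the number of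
132-avoiding permutations `σ` of `{1, …, k - 1}` with `k - σ₁ ≤ p` (the first entry in
one-based values is `σ 0 + 1`). The value at `k = 0` is not used. -/
noncomputable def leftCoeff {m : ℕ} (k : ℕ) (p : Threshold m) : ℕ :=
  match k with
  | 0 => 0
  | 1 => 1
  | k + 2 => (Finset.univ.filter fun σ : Equiv.Perm (Fin (k + 1)) =>
      Avoids132 σ ∧
        ((((k : ℤ) + 2) - (((σ 0 : ℕ) : ℤ) + 1) : ℤ) : WithTop ℤ) ≤ p.val).card

open Classical in
/-- The polynomial matrix of the endpoint-state system. The row `(p, q)` and column `(r, s)` entry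
is `∑_{k = 1}^m c_{k,p} x^k [(r, s) = (m - k, q - k)] + x [(r, s) = (p - 1, m - 1)]`. -/
noncomputable def W (m : ℕ) : Matrix (State m) (State m) ℂ[X] :=
  Matrix.of fun P R =>
    (∑ k ∈ Finset.Icc 1 m,
      if R.1.val = (((m : ℤ) - (k : ℤ) : ℤ) : WithTop ℤ) ∧ R.2.val = shift P.2.val k then
        C (leftCoeff k P.1 : ℂ) * X ^ k else 0) +
    (if R.1.val = shift P.1.val 1 ∧ R.2.val = (((m : ℤ) - 1 : ℤ) : WithTop ℤ) then X else 0)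

/-- The principal submatrix of `W m` with index set `S`, evaluated at `x`. -/
noncomputable def componentMatrix {m : ℕ} (S : Finset (State m)) (x : ℂ) : Matrix S S ℂ :=
  Matrix.of fun P R => (W m P.1 R.1).eval x

/-- The spectral radius of the principal submatrix with index set `S` at the real point `x`. -/
noncomputable def spr {m : ℕ} (S : Finset (State m)) (x : ℝ) : ENNReal :=
  spectralRadius ℂ (componentMatrix S (x : ℂ))

/-- `r` is the component radius of `S`: it lies in `(0, 1]` and is the unique positive real number
at which the spectral radius of the component matrix is `1`. -/
def IsComponentRadius {m : ℕ} (S : Finset (State m)) (r : ℝ) : Prop :=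
  0 < r ∧ r ≤ 1 ∧ ∀ x : ℝ, 0 < x → (spr S x = 1 ↔ x = r)

/-- The component `U_m = {(p, ∞) : 0 ≤ p ≤ m - 1}`. -/
def compU (m : ℕ) : Finset (State m) :=
  (Finset.univ : Finset (Fin m)).image fun p : Fin m => ((p : Threshold m), (⊤ : Threshold m))

/-- The component
`V_m = {(p, q) : 0 ≤ p, q ≤ m - 1, q < p} ∪ {(p, m - 1) : 0 ≤ p ≤ m - 2}`. -/
def compV (m : ℕ) : Finset (State m) :=
  ((Finset.univ : Finset (Fin m × Fin m)).filter fun a =>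
    a.2 < a.1 ∨ ((a.1 : ℕ) + 2 ≤ m ∧ (a.2 : ℕ) + 1 = m)).image
      fun a : Fin m × Fin m => ((a.1 : Threshold m), (a.2 : Threshold m))

end BoundedAvoid

/-! Cutting a 132-avoiding permutation at its largest entry makes every earlier entry exceed every
later one, so these permutations are binary trees (`card_perm_eq_card_tree`). The adjacency bound
and the end conditions depend only on the distances from the maximum to the first and last entries,
`headDef` and `lastDef`. A state `(p, q)` stands for nonempty bounded trees whose two deficits are
at most `p` and `q`. If the right part is nonempty and `k` is one more than the size of the left
part, the bound forces `k ≤ m`; the left part then meets the bound automatically, which gives the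
coefficients `c_{k,p}`. If the right part is empty, the left part gives the remaining entry `x`.
Hence the state series satisfy `F = x·1 + W F` (`stateSeries_eq`), and Cramer's rule makes the
generating function rational with denominator `det (1 - W)`.

The support graph of `W` is block triangular. Its cycles lie in `U`, in `V`, or in the loop of
weight `x` at `(⊤, m - 1)`, which matters only at `z = 1`. So a zero of the determinant other than
`1` is a kernel vector of `1 - W` restricted to `U` or `V` (`kernel_eq_zero`).

Both components are strongly connected. A compactness argument gives a point `r ≤ 1` at which the
component matrix has a positive eigenvector for the eigenvalue `1` (`exists_perronPair`). Since all
exponents are at least `1`, scaling `r` by `t` scales the matrix by at most `t` if `t ≤ 1` and by at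
least `t` if `t ≥ 1`, so `r` is the only point of spectral radius `1`. The eigenvector also bounds
the coefficients below by a multiple of `r⁻ⁿ` (`exists_le_coeff`).

A kernel vector at `z` with `‖z‖ ≤ r` forces equality in the triangle inequality, hence coherent
phases (`phases`). A cycle of length `ℓ` whose edges all have weight `x` then gives `z ^ ℓ = r ^ ℓ`.
`U` has such a loop; `V` has such cycles of lengths 2 and 3 if `m ≥ 3`; for `m = 2` one has `r_V = 1
> r_U`. So only `z = ρ` can be a zero in the closed disc, which gives the upper bound. The lower
bound shows that the pole at `ρ` does not cancel. -/

namespace BoundedAvoid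

open BinaryTree

/-! ### Lists that avoid 132 and binary trees -/

/-- A list of natural numbers avoids the pattern 132. -/
def ListAvoids (l : List ℕ) : Prop :=
  l.Triplewise fun a b c => ¬ (a < c ∧ c < b)

/-- The 132-avoiding list coded by a binary tree: the largest entry sits at the root, the entries
before it come from the left subtree and exceed the entries after it. -/
def treeList : BinaryTree Unit → List ℕ
  | .nil => []
  | .node _ L R =>
    (treeList L).map (· + R.numNodes) ++ (L.numNodes + R.numNodes) :: treeList R

theorem treeList_perm (t : BinaryTree Unit) : (treeList t).Perm (List.range t.numNodes) := by
  induction t with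
  | nil => simp [treeList]
  | node u L R hL hR =>
    simp only [treeList, numNodes]
    refine List.perm_middle.trans ?_
    rw [List.range_succ]
    refine List.Perm.trans ?_ (List.perm_append_singleton _ _).symm
    refine List.Perm.cons _ ?_
    rw [Nat.add_comm L.numNodes, List.range_add]
    refine List.perm_append_comm.trans (hR.append ?_)
    have := hL.map (· + R.numNodes)
    simpa [Nat.add_comm] using this

theorem length_treeList (t : BinaryTree Unit) : (treeList t).length = t.numNodes := by
  simpa using (treeList_perm t).length_eq

theorem lt_of_mem_treeList {t : BinaryTree Unit} {x : ℕ} (h : x ∈ treeList t) :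
    x < t.numNodes := by
  simpa using (treeList_perm t).mem_iff.1 h

/-- A 132 triple takes its smallest value first. Entries of `L` exceed those of `R` and `n` is the
maximum, so no triple meeting two of the three blocks is a 132. -/
theorem listAvoids_append_cons {L R : List ℕ} {n : ℕ} (hL : ∀ x ∈ L, x < n)
    (hR : ∀ x ∈ R, x < n) (hLR : ∀ x ∈ L, ∀ y ∈ R, y < x) :
    ListAvoids (L ++ n :: R) ↔ ListAvoids L ∧ ListAvoids R := by
  unfold ListAvoids
  rw [List.triplewise_append, List.triplewise_cons]
  constructor
  · rintro ⟨h1, ⟨_, h2⟩, _⟩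
    exact ⟨h1, h2⟩
  · rintro ⟨h1, h2⟩
    refine ⟨h1, ⟨?_, h2⟩, ?_, ?_⟩
    · refine List.pairwise_of_forall_mem_list fun a _ b hb => ?_
      have := hR b hb
      omega
    · intro a ha
      rw [List.pairwise_cons]
      refine ⟨fun b hb => ?_, List.pairwise_of_forall_mem_list fun b _ c hc => ?_⟩
      · have := hLR a ha b hb
        omega
      · have := hLR a ha c hc
        omega
    · intro c hc
      refine List.pairwise_of_forall_mem_list fun a ha b hb => ?_
      rcases List.mem_cons.1 hc with rfl | hc
      · have := hL b hb
        omega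
      · have := hLR a ha c hc
        omega

theorem listAvoids_map_add (l : List ℕ) (c : ℕ) :
    ListAvoids (l.map (· + c)) ↔ ListAvoids l := by
  unfold ListAvoids
  rw [List.triplewise_map]
  simp

theorem listAvoids_treeList (t : BinaryTree Unit) : ListAvoids (treeList t) := by
  induction t with
  | nil => simp [treeList, ListAvoids]
  | node u L R hL hR =>
    rw [treeList, listAvoids_append_cons, listAvoids_map_add]
    · exact ⟨hL, hR⟩
    · intro x hx
      obtain ⟨y, hy, rfl⟩ := List.mem_map.1 hx
      have := lt_of_mem_treeList hy
      omega
    · intro x hx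
      have := lt_of_mem_treeList hx
      omega
    · intro x hx z hz
      obtain ⟨y, hy, rfl⟩ := List.mem_map.1 hx
      have := lt_of_mem_treeList hz
      omega

/-- The two sizes have the same sum, so the maximum is the same number in both lists; it occurs once
and fixes the cut. -/
theorem treeList_injective : Function.Injective treeList := by
  intro t
  induction t with
  | nil =>
    intro s h
    have := length_treeList s
    rw [← h] at this
    cases s with
    | nil => rfl
    | node => simp [treeList] at this
  | node u L R hL hR =>
    intro s h
    have hlen := congrArg List.length h
    rw [length_treeList, length_treeList] at hlen
    cases s with
    | nil => simp at hlen
    | node v L' R' =>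
      simp only [numNodes, add_left_inj] at hlen
      simp only [treeList] at h
      rw [hlen, List.append_cons_inj_of_notMem] at h
      · obtain ⟨h1, -, h2⟩ := h
        obtain rfl := hR h2
        obtain rfl := hL (List.map_injective_iff.2 (add_left_injective _) h1)
        rfl
      · intro hx
        obtain ⟨y, hy, hy'⟩ := List.mem_map.1 hx
        have := lt_of_mem_treeList hy
        omega
      · intro hx
        have := lt_of_mem_treeList hx
        omega

theorem perm_range_of_nodup {l : List ℕ} (hd : l.Nodup) (h : ∀ x ∈ l, x < l.length) :
    l.Perm (List.range l.length) :=
  (List.subperm_of_subset hd fun x hx => by simpa using h x hx).perm_of_length_le (by simp)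

theorem exists_treeList_eq (n : ℕ) : ∀ l : List ℕ, l.Perm (List.range n) → ListAvoids l →
    ∃ t, treeList t = l := by
  induction n using Nat.strong_induction_on with
  | _ n ih =>
    intro l hl ha
    rcases n with _ | n
    · exact ⟨.nil, by simpa [treeList, eq_comm] using hl⟩
    obtain ⟨L, R, rfl⟩ := List.append_of_mem (hl.mem_iff.2 (by simp : n ∈ List.range (n + 1)))
    have hLR : (L ++ R).Perm (List.range n) := by
      refine List.Perm.cons_inv (a := n) ?_
      refine List.perm_middle.symm.trans (hl.trans ?_)
      rw [List.range_succ]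
      exact List.perm_append_singleton _ _
    have hnd : (L ++ R).Nodup := hLR.nodup_iff.2 List.nodup_range
    have hlen : L.length + R.length = n := by simpa using hLR.length_eq
    have hmem : ∀ x, x ∈ L ∨ x ∈ R ↔ x < n := fun x => by simpa using hLR.mem_iff (a := x)
    rw [List.nodup_append'] at hnd
    obtain ⟨hLn, hRn, hdis⟩ := hnd
    -- Otherwise `x`, the maximum `n` and `y` would form a 132.
    have hcross : ∀ x ∈ L, ∀ y ∈ R, y < x := by
      intro x hx y hy
      unfold ListAvoids at ha
      rw [List.triplewise_append] at ha
      have h1 := (List.pairwise_cons.1 (ha.2.2.1 x hx)).1 y hy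
      have h2 := (hmem y).1 (Or.inr hy)
      have h3 : x ≠ y := fun h => hdis hx (h ▸ hy)
      omega
    -- By `hcross`, `R` is closed downwards, so it contains all of `0, …, y`.
    have hRlt : ∀ y ∈ R, y < R.length := by
      intro y hy
      have : List.range (y + 1) ⊆ R := by
        intro z hz
        have hz' : z ≤ y := by simpa [Nat.lt_succ_iff] using hz
        have hzn : z < n := hz'.trans_lt ((hmem y).1 (Or.inr hy))
        rcases (hmem z).2 hzn with h | h
        · have := hcross z h y hy
          omega
        · exact h
      simpa using (List.subperm_of_subset List.nodup_range this).length_le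
    have hRp := perm_range_of_nodup hRn hRlt
    have hLge : ∀ x ∈ L, R.length ≤ x := by
      intro x hx
      by_contra hlt
      exact hdis hx (hRp.mem_iff.2 (by simpa using hlt))
    have hLmap : (L.map (· - R.length)).map (· + R.length) = L := by
      rw [List.map_map]
      conv_rhs => rw [← List.map_id L]
      refine List.map_congr_left fun x hx => ?_
      have := hLge x hx
      simp only [Function.comp_apply, id_eq]
      omega
    have hLp : (L.map (· - R.length)).Perm (List.range L.length) := by
      have := perm_range_of_nodup (l := L.map (· - R.length)) ?_ ?_
      · simpa using this
      · refine List.Nodup.map_on (fun x hx y hy h => ?_) hLn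
        have := hLge x hx
        have := hLge y hy
        omega
      · intro z hz
        obtain ⟨x, hx, rfl⟩ := List.mem_map.1 hz
        have := hLge x hx
        have := (hmem x).1 (Or.inl hx)
        simp only [List.length_map]
        omega
    rw [listAvoids_append_cons (fun x hx => (hmem x).1 (Or.inl hx))
      (fun x hx => (hmem x).1 (Or.inr hx)) hcross] at ha
    obtain ⟨tR, htR⟩ := ih R.length (by omega) R hRp ha.2
    obtain ⟨tL, htL⟩ := ih L.length (by omega) _ hLp (by
      rw [← listAvoids_map_add _ R.length, hLmap]
      exact ha.1)
    refine ⟨.node () tL tR, ?_⟩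
    have h1 : tR.numNodes = R.length := by rw [← length_treeList, htR]
    have h2 : tL.numNodes = L.length := by rw [← length_treeList, htL, List.length_map]
    rw [treeList, htL, htR, h1, h2, hLmap, hlen]

/-! ### Permutations as lists -/

/-- The one-line notation of a permutation. -/
def permList {n : ℕ} (π : Equiv.Perm (Fin n)) : List ℕ := List.ofFn fun i => (π i : ℕ)

theorem permList_injective {n : ℕ} : Function.Injective (permList (n := n)) := by
  intro π σ h
  have := List.ofFn_injective h
  ext i
  exact congrFun this i

theorem permList_perm {n : ℕ} (π : Equiv.Perm (Fin n)) :
    (permList π).Perm (List.range n) := by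
  have h : (permList π).length = n := by simp [permList]
  have := perm_range_of_nodup (l := permList π) ?_ ?_
  · rwa [h] at this
  · rw [permList, List.nodup_ofFn]
    exact Fin.val_injective.comp π.injective
  · intro x hx
    rw [h]
    obtain ⟨i, rfl⟩ := (List.mem_ofFn' _ _).1 hx
    exact (π i).isLt

theorem exists_permList_eq {n : ℕ} {l : List ℕ} (h : l.Perm (List.range n)) :
    ∃ π : Equiv.Perm (Fin n), permList π = l := by
  have hlen : l.length = n := by simpa using h.length_eq
  have hnd : l.Nodup := h.nodup_iff.2 List.nodup_range
  have hlt : ∀ i : Fin n, l[i] < n := fun i => by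
    simpa using h.mem_iff.1 (List.getElem_mem (l := l) (n := i) (by omega))
  have hinj : Function.Injective fun i : Fin n => (⟨l[i], hlt i⟩ : Fin n) := by
    intro i j hij
    have : l[i] = l[j] := congrArg Fin.val hij
    exact Fin.ext ((hnd.getElem_inj_iff).1 this)
  refine ⟨Equiv.ofBijective _ (Finite.injective_iff_bijective.1 hinj), ?_⟩
  refine List.ext_getElem (by simp [permList, hlen]) fun i h1 h2 => ?_
  simp [permList]

theorem avoids132_iff {n : ℕ} (π : Equiv.Perm (Fin n)) :
    Avoids132 π ↔ ListAvoids (permList π) := by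
  unfold Avoids132 ListAvoids
  rw [List.triplewise_iff_getElem]
  push Not
  constructor
  · intro h i j k hij hjk hk h1
    have hk' : k < n := by simpa [permList] using hk
    have := h ⟨i, by omega⟩ ⟨j, by omega⟩ ⟨k, hk'⟩ hij hjk (by simpa [permList] using h1)
    simpa [permList] using this
  · intro h i j k hij hjk h1
    have := h i j k hij hjk (by simp [permList]) (by simpa [permList] using h1)
    simpa [permList] using this

theorem isBounded_iff (m : ℕ) {n : ℕ} (π : Equiv.Perm (Fin n)) :
    IsBounded m π ↔
      (permList π).IsChain (fun a b : ℕ => |((b : ℕ) : ℤ) - ((a : ℕ) : ℤ)| ≤ m) := by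
  unfold IsBounded
  rw [List.isChain_iff_getElem]
  constructor
  · intro h i hi
    have hi' : i + 1 < n := by simpa [permList] using hi
    simpa [permList] using h ⟨i, by omega⟩ ⟨i + 1, hi'⟩ rfl
  · intro h i j hij
    have hi : (i : ℕ) + 1 < (permList π).length := by simp [permList]; omega
    have := h i hi
    simpa [permList, hij] using this

open Classical in
/-- Counting 132-avoiding permutations by a property of their one-line notation is counting binary
trees. -/
theorem card_perm_eq_card_tree (n : ℕ) (Q : List ℕ → Prop) :
    (Finset.univ.filter fun π : Equiv.Perm (Fin n) => Avoids132 π ∧ Q (permList π)).card =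
      ((treesOfNumNodesEq n).filter fun t => Q (treeList t)).card := by
  rw [← Finset.card_image_of_injective _ (permList_injective (n := n)),
    ← Finset.card_image_of_injective _ treeList_injective]
  congr 1
  ext l
  simp only [Finset.mem_image, Finset.mem_filter, Finset.mem_univ, true_and,
    mem_treesOfNumNodesEq]
  constructor
  · rintro ⟨π, ⟨h1, h2⟩, rfl⟩
    obtain ⟨t, ht⟩ := exists_treeList_eq n _ (permList_perm π) ((avoids132_iff π).1 h1)
    refine ⟨t, ⟨?_, ht ▸ h2⟩, ht⟩
    rw [← length_treeList, ht]
    simp [permList]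
  · rintro ⟨t, ⟨h1, h2⟩, rfl⟩
    obtain ⟨π, hπ⟩ := exists_permList_eq (n := n) (l := treeList t) (h1 ▸ treeList_perm t)
    exact ⟨π, ⟨(avoids132_iff π).2 (hπ ▸ listAvoids_treeList t), hπ ▸ h2⟩, hπ⟩

/-! ### Endpoint statistics of trees -/

/-- The deficit of the first entry: the largest entry minus the first one. -/
def headDef : BinaryTree Unit → ℕ
  | .nil => 0
  | .node _ L _ => if L = .nil then 0 else headDef L + 1

/-- The deficit of the last entry: the largest entry minus the last one. -/
def lastDef : BinaryTree Unit → ℕ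
  | .nil => 0
  | .node _ L R => if R = .nil then 0 else L.numNodes + 1 + lastDef R

/-- The tree codes a list whose consecutive entries differ by at most `m`. -/
def TreeBdd (m : ℕ) : BinaryTree Unit → Prop
  | .nil => True
  | .node _ L R => TreeBdd m L ∧ TreeBdd m R ∧ (L ≠ .nil → lastDef L + 1 ≤ m) ∧
      (R ≠ .nil → L.numNodes + 1 + headDef R ≤ m)

theorem treeList_eq_nil {t : BinaryTree Unit} : treeList t = [] ↔ t = .nil := by
  cases t <;> simp [treeList]

theorem head_treeList {t : BinaryTree Unit} : ∀ x ∈ (treeList t).head?,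
    x + headDef t + 1 = t.numNodes := by
  induction t with
  | nil => simp [treeList]
  | node u L R hL _ =>
    intro x hx
    by_cases h : L = .nil
    · subst h
      simp [treeList] at hx
      simp [headDef, hx]
    · obtain ⟨a, l, hl⟩ := List.exists_cons_of_ne_nil (mt treeList_eq_nil.1 h)
      have := hL a (by simp [hl])
      simp [treeList, hl] at hx
      simp [headDef, h, numNodes]
      omega

theorem last_treeList {t : BinaryTree Unit} : ∀ x ∈ (treeList t).getLast?,
    x + lastDef t + 1 = t.numNodes := by
  induction t with
  | nil => simp [treeList]
  | node u L R _ hR =>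
    intro x hx
    by_cases h : R = .nil
    · subst h
      simp [treeList] at hx
      simp [lastDef, hx]
    · obtain ⟨a, ha⟩ := List.getLast?_isSome.2 (mt treeList_eq_nil.1 h) |> Option.isSome_iff_exists.1
      have := hR a (by simp [ha])
      simp [treeList, List.getLast?_append, List.getLast?_cons, ha] at hx
      simp [lastDef, h, numNodes]
      omega

/-- Adding a constant preserves differences, so only the two adjacencies at the maximum are new. The
step up from the left part is `lastDef L + 1`; the step down to the right part is `L.numNodes + 1 +
headDef R`. -/
theorem isChain_treeList (m : ℕ) (t : BinaryTree Unit) :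
    (treeList t).IsChain (fun a b : ℕ => |((b : ℕ) : ℤ) - ((a : ℕ) : ℤ)| ≤ m) ↔ TreeBdd m t := by
  induction t with
  | nil => simp [treeList, TreeBdd]
  | node u L R hL hR =>
    rw [treeList, List.isChain_append, List.isChain_cons, hR, List.isChain_map, TreeBdd]
    simp only [Nat.cast_add, add_sub_add_right_eq_sub]
    rw [hL]
    have h1 : (∀ y ∈ (treeList R).head?, |(y : ℤ) - (L.numNodes + R.numNodes)| ≤ m) ↔
        (R ≠ .nil → L.numNodes + 1 + headDef R ≤ m) := by
      by_cases h : R = .nil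
      · simp [h, treeList]
      · obtain ⟨a, l, hl⟩ := List.exists_cons_of_ne_nil (mt treeList_eq_nil.1 h)
        have := head_treeList (t := R) a (by simp [hl])
        simp only [hl, List.head?_cons, Option.mem_def, Option.some.injEq, forall_eq', ne_eq, h,
          not_false_eq_true, forall_const, abs_le]
        omega
    have h2 : (∀ x ∈ ((treeList L).map (· + R.numNodes)).getLast?,
        ∀ y ∈ (((L.numNodes + R.numNodes) :: treeList R).head?), |(y : ℤ) - (x : ℤ)| ≤ m) ↔
        (L ≠ .nil → lastDef L + 1 ≤ m) := by
      by_cases h : L = .nil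
      · simp [h, treeList]
      · obtain ⟨a, ha⟩ :=
          List.getLast?_isSome.2 (mt treeList_eq_nil.1 h) |> Option.isSome_iff_exists.1
        have := last_treeList (t := L) a (by simp [ha])
        simp only [List.getLast?_map, ha, Option.map_some, Option.mem_def, Option.some.injEq,
          forall_eq', List.head?_cons, ne_eq, h, not_false_eq_true, forall_const, abs_le]
        omega
    rw [h1, h2]
    tauto

theorem lastDef_lt {t : BinaryTree Unit} (h : t ≠ .nil) : lastDef t < t.numNodes := by
  obtain ⟨a, ha⟩ := List.getLast?_isSome.2 (mt treeList_eq_nil.1 h) |> Option.isSome_iff_exists.1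
  have := last_treeList (t := t) a (by simp [ha])
  omega

theorem headDef_lt {t : BinaryTree Unit} (h : t ≠ .nil) : headDef t < t.numNodes := by
  obtain ⟨a, l, hl⟩ := List.exists_cons_of_ne_nil (mt treeList_eq_nil.1 h)
  have := head_treeList (t := t) a (by simp [hl])
  omega

/-- This frees the left subtree from the adjacency bound whenever a right subtree is present. -/
theorem treeBdd_of_numNodes_le {m : ℕ} {t : BinaryTree Unit} (h : t.numNodes ≤ m) :
    TreeBdd m t := by
  induction t with
  | nil => trivial
  | node u L R hL hR =>
    simp only [numNodes] at h
    refine ⟨hL (by omega), hR (by omega), fun h' => ?_, fun h' => ?_⟩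
    · have := lastDef_lt h'
      omega
    · have := headDef_lt h'
      omega

theorem count_eq_card_tree (m n : ℕ) [DecidablePred (TreeBdd m)] :
    count m n = ((treesOfNumNodesEq n).filter (TreeBdd m)).card := by
  classical
  have := card_perm_eq_card_tree n
    fun l => l.IsChain (fun a b : ℕ => |((b : ℕ) : ℤ) - ((a : ℕ) : ℤ)| ≤ m)
  rw [count, avoiders]
  simp only [isBounded_iff]
  convert this using 3
  · rw [isChain_treeList]

end BoundedAvoid

namespace BoundedAvoid

open BinaryTree

/-! ### Thresholds -/

@[simp] theorem Threshold.val_coe {m : ℕ} (i : Fin m) :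
    Threshold.val (i : Threshold m) = (((i : ℕ) : ℤ) : WithTop ℤ) := rfl

@[simp] theorem Threshold.val_top {m : ℕ} : Threshold.val (⊤ : Threshold m) = ⊤ := rfl

@[simp] theorem shift_coe (z : ℤ) (k : ℕ) : shift (z : WithTop ℤ) k = ((z - k : ℤ) : WithTop ℤ) :=
  rfl

@[simp] theorem shift_top (k : ℕ) : shift ⊤ k = ⊤ := rfl

theorem Threshold.val_injective {m : ℕ} : Function.Injective (Threshold.val (m := m)) := by
  intro p q h
  induction p using WithTop.recTopCoe <;> induction q using WithTop.recTopCoe <;>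
    simp_all [Fin.ext_iff]

theorem Threshold.val_nonneg {m : ℕ} (p : Threshold m) : 0 ≤ p.val := by
  induction p using WithTop.recTopCoe with
  | top => simp
  | coe i =>
    rw [Threshold.val_coe, ← WithTop.coe_zero, WithTop.coe_le_coe]
    positivity

theorem Threshold.exists_val_eq {m : ℕ} {α : WithTop ℤ} (h0 : 0 ≤ α)
    (h : α < ((m : ℤ) : WithTop ℤ) ∨ α = ⊤) : ∃ p : Threshold m, p.val = α := by
  induction α using WithTop.recTopCoe with
  | top => exact ⟨⊤, rfl⟩
  | coe z =>
    rw [← WithTop.coe_zero, WithTop.coe_le_coe] at h0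
    simp only [WithTop.coe_lt_coe, WithTop.coe_ne_top, or_false] at h
    refine ⟨((⟨z.toNat, by omega⟩ : Fin m) : Threshold m), ?_⟩
    simp [h0]

theorem coe_add_le_iff (d k : ℕ) (a : WithTop ℤ) :
    ((((d + k : ℕ) : ℤ)) : WithTop ℤ) ≤ a ↔ (((d : ℕ) : ℤ) : WithTop ℤ) ≤ shift a k := by
  induction a using WithTop.recTopCoe with
  | top => simp
  | coe z =>
    rw [shift_coe, WithTop.coe_le_coe, WithTop.coe_le_coe]
    omega

theorem coe_le_coe_sub_iff (d k m : ℕ) :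
    (((d : ℕ) : ℤ) : WithTop ℤ) ≤ (((m : ℤ) - (k : ℤ) : ℤ) : WithTop ℤ) ↔ k + d ≤ m := by
  rw [WithTop.coe_le_coe]
  omega

theorem shift_lt_or_eq_top {m : ℕ} (p : Threshold m) (k : ℕ) :
    shift p.val k < ((m : ℤ) : WithTop ℤ) ∨ shift p.val k = ⊤ := by
  induction p using WithTop.recTopCoe with
  | top => simp
  | coe i =>
    left
    rw [Threshold.val_coe, shift_coe, WithTop.coe_lt_coe]
    have := i.isLt
    omega

/-- Summing over states with prescribed endpoint values evaluates a function of the values that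
vanishes at negative arguments. -/
theorem sum_state_ite {m : ℕ} {M : Type*} [AddCommMonoid M] (g : WithTop ℤ → WithTop ℤ → M)
    (hg : ∀ α β, α < 0 ∨ β < 0 → g α β = 0) {α β : WithTop ℤ}
    (hα : α < ((m : ℤ) : WithTop ℤ) ∨ α = ⊤) (hβ : β < ((m : ℤ) : WithTop ℤ) ∨ β = ⊤)
    [∀ R : State m, Decidable (R.1.val = α ∧ R.2.val = β)] :
    (∑ R : State m, if R.1.val = α ∧ R.2.val = β then g R.1.val R.2.val else 0) = g α β := by
  by_cases h : α < 0 ∨ β < 0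
  · rw [hg α β h]
    refine Finset.sum_eq_zero fun R _ => ?_
    split_ifs with hR
    · rw [hR.1, hR.2, hg α β h]
    · rfl
  · push Not at h
    obtain ⟨p, rfl⟩ := Threshold.exists_val_eq h.1 hα
    obtain ⟨q, rfl⟩ := Threshold.exists_val_eq h.2 hβ
    rw [Finset.sum_eq_single (p, q)]
    · simp
    · intro R _ hR
      rw [if_neg]
      rintro ⟨h1, h2⟩
      exact hR (Prod.ext (Threshold.val_injective h1) (Threshold.val_injective h2))
    · simp

/-! ### Counting trees by endpoint deficits -/

open Classical in
/-- The number of nonempty `m`-bounded trees with `n` nodes whose endpoint deficits are at most `a`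
and `b`. -/
noncomputable def endCount (m : ℕ) (a b : WithTop ℤ) (n : ℕ) : ℕ :=
  ((treesOfNumNodesEq n).filter fun t => t ≠ .nil ∧ TreeBdd m t ∧
    ((headDef t : ℤ) : WithTop ℤ) ≤ a ∧ ((lastDef t : ℤ) : WithTop ℤ) ≤ b).card

theorem endCount_zero (m : ℕ) (a b : WithTop ℤ) : endCount m a b 0 = 0 := by
  simp [endCount, Finset.filter_singleton]

/-- Shifted thresholds may become negative and leave the set of states; such terms contribute
nothing. -/
theorem endCount_eq_zero (m : ℕ) {a b : WithTop ℤ} (h : a < 0 ∨ b < 0) (n : ℕ) :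
    endCount m a b n = 0 := by
  classical
  rw [endCount, Finset.card_eq_zero, Finset.filter_eq_empty_iff]
  rintro t - ⟨-, -, h1, h2⟩
  have key : ∀ (d : ℕ) (a : WithTop ℤ), ((d : ℤ) : WithTop ℤ) ≤ a → ¬ a < 0 := by
    intro d a hd ha
    have := hd.trans_lt ha
    rw [← WithTop.coe_zero, WithTop.coe_lt_coe] at this
    omega
  exact h.elim (key _ _ h1) (key _ _ h2)

theorem count_eq_endCount (m n : ℕ) (hn : n ≠ 0) : count m n = endCount m ⊤ ⊤ n := by
  classical
  rw [count_eq_card_tree, endCount]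
  congr 1
  refine Finset.filter_congr fun t ht => ?_
  have : t ≠ .nil := by
    rintro rfl
    exact hn (mem_treesOfNumNodesEq.1 ht).symm
  simp [this]

theorem endCount_mono (m : ℕ) {a b a' b' : WithTop ℤ} (ha : a ≤ a') (hb : b ≤ b') (n : ℕ) :
    endCount m a b n ≤ endCount m a' b' n := by
  refine Finset.card_le_card fun t => ?_
  simp only [Finset.mem_filter]
  rintro ⟨h1, h2, h3, h4, h5⟩
  exact ⟨h1, h2, h3, h4.trans ha, h5.trans hb⟩

open Classical in
/-- The number of trees with `k - 1` nodes that can form the left subtree of a tree with head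
deficit at most `a`. -/
noncomputable def leftCount (k : ℕ) (a : WithTop ℤ) : ℕ :=
  ((treesOfNumNodesEq (k - 1)).filter fun t => t ≠ .nil →
    ((headDef t + 1 : ℕ) : ℤ) ≤ a).card

theorem leftCoeff_eq_leftCount {m : ℕ} {k : ℕ} (hk : k ≠ 0) (p : Threshold m) :
    leftCoeff k p = leftCount k p.val := by
  classical
  match k with
  | 0 => exact absurd rfl hk
  | 1 => simp [leftCoeff, leftCount, Finset.filter_singleton]
  | k + 2 =>
    obtain ⟨Q, hQ⟩ : ∃ Q : List ℕ → Prop, ∀ l, Q l ↔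
        ∀ x ∈ l.head?, ((((k : ℤ) + 2) - ((x : ℤ) + 1) : ℤ) : WithTop ℤ) ≤ p.val :=
      ⟨_, fun _ => Iff.rfl⟩
    rw [leftCoeff, leftCount]
    refine Eq.trans ?_ ((card_perm_eq_card_tree (k + 1) Q).trans ?_)
    · congr 1
      refine Finset.filter_congr fun π _ => and_congr_right fun _ => ?_
      rw [hQ]
      simp only [permList, List.ofFn_succ, List.head?_cons, Option.mem_def, Option.some.injEq,
        forall_eq']
    · congr 1
      refine Finset.filter_congr fun t ht => ?_
      have ht : t.numNodes = k + 1 := by simpa using ht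
      have hne : t ≠ .nil := by
        rintro rfl
        simp at ht
      obtain ⟨a, l, hl⟩ := List.exists_cons_of_ne_nil (mt treeList_eq_nil.1 hne)
      have hh := head_treeList (t := t) a (by simp [hl])
      -- The extra `1` in the deficit is the step from the maximum of the left block to the maximum
      -- of the whole permutation.
      have : ((headDef t + 1 : ℕ) : ℤ) = (k : ℤ) + 2 - ((a : ℤ) + 1) := by omega
      rw [hQ, hl, this]
      simp only [List.head?_cons, Option.mem_def, Option.some.injEq, forall_eq', hne, ne_eq,
        not_false_eq_true, forall_const]

theorem card_filter_trees_succ (n : ℕ) (P : BinaryTree Unit → Prop) [DecidablePred P] :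
    ((treesOfNumNodesEq (n + 1)).filter P).card =
      ∑ i ∈ Finset.range (n + 1), ((treesOfNumNodesEq i ×ˢ treesOfNumNodesEq (n - i)).filter
        fun t => P (.node () t.1 t.2)).card := by
  rw [treesOfNumNodesEq_succ, Finset.filter_biUnion, Finset.card_biUnion,
    ← Finset.Nat.sum_antidiagonal_eq_sum_range_succ
      (fun i j => ((treesOfNumNodesEq i ×ˢ treesOfNumNodesEq j).filter
        fun t => P (.node () t.1 t.2)).card)]
  · refine Finset.sum_congr rfl fun ij _ => ?_
    rw [Finset.filter_map, Finset.card_map]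
    rfl
  · intro x _ y _ hxy
    refine Finset.disjoint_left.2 fun t hx hy => hxy ?_
    simp only [Finset.mem_filter, Finset.mem_map, Finset.mem_product, mem_treesOfNumNodesEq]
      at hx hy
    obtain ⟨⟨s, ⟨h1, h2⟩, rfl⟩, -⟩ := hx
    obtain ⟨⟨s', ⟨h3, h4⟩, h5⟩, -⟩ := hy
    have h6 : BinaryTree.node () s'.1 s'.2 = .node () s.1 s.2 := h5
    rw [BinaryTree.node.injEq] at h6
    rw [h6.2.1] at h3
    rw [h6.2.2] at h4
    exact Prod.ext (h1.symm.trans h3) (h2.symm.trans h4)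

-- Empty right subtree: the maximum stands last, so `b` imposes nothing, and the last entry of the
-- left part must be within `m` of the maximum.
open Classical in
theorem card_left_only (m : ℕ) {a b : WithTop ℤ} (ha : 0 ≤ a) (hb : 0 ≤ b) (n : ℕ) :
    ((treesOfNumNodesEq n ×ˢ treesOfNumNodesEq 0).filter fun t : _ × _ =>
      BinaryTree.node () t.1 t.2 ≠ .nil ∧ TreeBdd m (.node () t.1 t.2) ∧
        ((headDef (.node () t.1 t.2) : ℤ) : WithTop ℤ) ≤ a ∧
        ((lastDef (.node () t.1 t.2) : ℤ) : WithTop ℤ) ≤ b).card =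
      (if n = 0 then 1 else 0) +
        endCount m (shift a 1) (((m : ℤ) - 1 : ℤ) : WithTop ℤ) n := by
  rcases Nat.eq_zero_or_pos n with rfl | hn
  · simp [endCount_zero, Finset.filter_singleton, TreeBdd, headDef, lastDef, ha, hb]
  · rw [if_neg hn.ne', zero_add, endCount, treesOfNumNodesEq_zero, Finset.product_singleton,
      Finset.filter_map, Finset.card_map]
    congr 1
    refine Finset.filter_congr fun t ht => ?_
    have hne : t ≠ .nil := by
      rintro rfl
      exact hn.ne (mem_treesOfNumNodesEq.1 ht)
    have := coe_add_le_iff (headDef t) 1 a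
    have h2 := coe_le_coe_sub_iff (lastDef t) 1 m
    push_cast at this h2
    simp only [Function.comp_apply, Function.Embedding.coeFn_mk, TreeBdd, headDef, lastDef, hne,
      ne_eq, not_false_eq_true, reduceCtorEq, not_true_eq_false, if_true, if_false, forall_const,
      true_and, Nat.cast_zero, WithTop.coe_zero, hb, and_true, IsEmpty.forall_iff]
    push_cast
    rw [this, h2, add_comm 1]
    tauto

-- Nonempty right subtree: the step down from the maximum forces `i + 1 ≤ m`. Then the conditions
-- separate: the left part sees only `a`, the right part only `m - (i + 1)` and the shifted `b`, so
-- the count is a product.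
open Classical in
theorem card_left_right (m : ℕ) (a b : WithTop ℤ) (i j : ℕ) (hj : j ≠ 0) :
    ((treesOfNumNodesEq i ×ˢ treesOfNumNodesEq j).filter fun t : _ × _ =>
      BinaryTree.node () t.1 t.2 ≠ .nil ∧ TreeBdd m (.node () t.1 t.2) ∧
        ((headDef (.node () t.1 t.2) : ℤ) : WithTop ℤ) ≤ a ∧
        ((lastDef (.node () t.1 t.2) : ℤ) : WithTop ℤ) ≤ b).card =
      if 0 ≤ a ∧ i + 1 ≤ m then leftCount (i + 1) a *
        endCount m (((m : ℤ) - ((i + 1 : ℕ) : ℤ) : ℤ) : WithTop ℤ) (shift b (i + 1)) j else 0 := by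
  split_ifs with h
  · rw [leftCount, endCount, ← Finset.card_product, ← Finset.filter_product]
    congr 1
    refine Finset.filter_congr fun t ht => ?_
    obtain ⟨L, R⟩ := t
    simp only [Finset.mem_product, mem_treesOfNumNodesEq] at ht
    obtain ⟨hL, hR⟩ := ht
    have hne : R ≠ .nil := by
      rintro rfl
      exact hj hR.symm
    have hbd : TreeBdd m L := treeBdd_of_numNodes_le (by omega)
    have hlast : L ≠ .nil → lastDef L + 1 ≤ m := fun hL' => by
      have := lastDef_lt hL'
      omega
    have h1 := coe_le_coe_sub_iff (headDef R) (i + 1) m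
    have h2 := coe_add_le_iff (lastDef R) (i + 1) b
    have h3 : ((headDef (.node () L R) : ℤ) : WithTop ℤ) ≤ a ↔
        (L ≠ .nil → (((headDef L + 1 : ℕ) : ℤ) : WithTop ℤ) ≤ a) := by
      by_cases hLn : L = .nil
      · simp [hLn, headDef, h.1]
      · simp [hLn, headDef]
    simp only [h3, h1, ← h2]
    simp only [TreeBdd, lastDef, hbd, hne, hL, ne_eq, not_false_eq_true, reduceCtorEq, if_false,
      forall_const, true_and, add_comm (i + 1)]
    tauto
  · rw [Finset.card_eq_zero, Finset.filter_eq_empty_iff]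
    rintro ⟨L, R⟩ ht ⟨-, hb, hh, -⟩
    simp only [Finset.mem_product, mem_treesOfNumNodesEq] at ht
    obtain ⟨hL, hR⟩ := ht
    refine h ⟨le_trans ?_ hh, ?_⟩
    · rw [← WithTop.coe_zero, WithTop.coe_le_coe]
      positivity
    · have hne : R ≠ .nil := by
        rintro rfl
        exact hj hR.symm
      have : L.numNodes + 1 + headDef R ≤ m := hb.2.2.2 hne
      omega

theorem endCount_succ (m : ℕ) {a b : WithTop ℤ} (ha : 0 ≤ a) (hb : 0 ≤ b) (n : ℕ) :
    endCount m a b (n + 1) = (if n = 0 then 1 else 0) +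
      (∑ k ∈ Finset.Icc 1 m, if k ≤ n + 1 then leftCount k a *
        endCount m (((m : ℤ) - (k : ℤ) : ℤ) : WithTop ℤ) (shift b k) (n + 1 - k) else 0) +
      endCount m (shift a 1) (((m : ℤ) - 1 : ℤ) : WithTop ℤ) n := by
  classical
  rw [endCount, card_filter_trees_succ, Finset.sum_range_succ, Nat.sub_self,
    card_left_only m ha hb]
  have : ∑ k ∈ Finset.Icc 1 m, (if k ≤ n + 1 then leftCount k a *
      endCount m (((m : ℤ) - (k : ℤ) : ℤ) : WithTop ℤ) (shift b k) (n + 1 - k) else 0) =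
      ∑ i ∈ Finset.range n, if 0 ≤ a ∧ i + 1 ≤ m then leftCount (i + 1) a *
        endCount m (((m : ℤ) - ((i + 1 : ℕ) : ℤ) : ℤ) : WithTop ℤ) (shift b (i + 1)) (n - i)
        else 0 := by
    rw [← Finset.sum_filter, ← Finset.sum_filter]
    symm
    -- The added term `i = n` would have an empty right subtree, and `endCount` vanishes there. It
    -- has to be allowed because `k = n + 1` occurs in the other sum.
    rw [Finset.sum_subset (s₂ := (Finset.range (n + 1)).filter fun i => 0 ≤ a ∧ i + 1 ≤ m)]
    · refine Finset.sum_bij (fun i _ => i + 1) ?_ ?_ ?_ ?_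
      · intro i hi
        simp only [Finset.mem_filter, Finset.mem_range, Finset.mem_Icc] at hi ⊢
        omega
      · intro i _ j _ h
        omega
      · intro k hk
        simp only [Finset.mem_filter, Finset.mem_Icc] at hk
        refine ⟨k - 1, ?_, by omega⟩
        simp only [Finset.mem_filter, Finset.mem_range]
        exact ⟨by omega, ha, by omega⟩
      · intro i _
        rw [Nat.add_sub_add_right]
    · intro i
      simp only [Finset.mem_filter, Finset.mem_range]
      exact fun h => ⟨by omega, h.2⟩
    · intro i h1 h2
      simp only [Finset.mem_filter, Finset.mem_range] at h1 h2
      have : i = n := by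
        by_contra hne
        exact h2 ⟨by omega, h1.2⟩
      subst this
      rw [Nat.sub_self, endCount_zero, mul_zero]
  rw [this, add_left_comm, ← add_assoc]
  congr 2
  refine Finset.sum_congr rfl fun i hi => ?_
  exact card_left_right m a b i (n - i) (by have := Finset.mem_range.1 hi; omega)

/-! ### The endpoint-state system -/

/-- The generating function of the numbers `endCount m a b n`. -/
noncomputable def endSeries (m : ℕ) (a b : WithTop ℤ) : PowerSeries ℕ :=
  PowerSeries.mk (endCount m a b)

theorem endSeries_eq_zero (m : ℕ) (a b : WithTop ℤ) (h : a < 0 ∨ b < 0) :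
    endSeries m a b = 0 := by
  ext n
  simp [endSeries, endCount_eq_zero m h]

theorem endSeries_eq (m : ℕ) {a b : WithTop ℤ} (ha : 0 ≤ a) (hb : 0 ≤ b) :
    endSeries m a b = PowerSeries.X +
      (∑ k ∈ Finset.Icc 1 m, PowerSeries.C (leftCount k a) * (PowerSeries.X ^ k *
        endSeries m (((m : ℤ) - (k : ℤ) : ℤ) : WithTop ℤ) (shift b k))) +
      PowerSeries.X * endSeries m (shift a 1) (((m : ℤ) - 1 : ℤ) : WithTop ℤ) := by
  ext n
  simp only [map_add, map_sum, PowerSeries.coeff_C_mul, PowerSeries.coeff_X_pow_mul',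
    PowerSeries.coeff_X, endSeries, PowerSeries.coeff_mk]
  rcases n with _ | n
  · simp only [endCount_zero, PowerSeries.coeff_zero_X_mul]
    rw [Finset.sum_eq_zero]
    · simp
    · intro k hk
      rw [Finset.mem_Icc] at hk
      simp
      omega
  · rw [endCount_succ m ha hb, PowerSeries.coeff_succ_X_mul]
    simp [mul_ite]

open Classical in
/-- The matrix `W m` with natural coefficients. -/
noncomputable def stepMatrix (m : ℕ) : Matrix (State m) (State m) ℕ[X] :=
  Matrix.of fun P R =>
    (∑ k ∈ Finset.Icc 1 m,
      if R.1.val = (((m : ℤ) - (k : ℤ) : ℤ) : WithTop ℤ) ∧ R.2.val = shift P.2.val k then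
        C (leftCoeff k P.1) * X ^ k else 0) +
    (if R.1.val = shift P.1.val 1 ∧ R.2.val = (((m : ℤ) - 1 : ℤ) : WithTop ℤ) then X else 0)

theorem W_apply (m : ℕ) (P R : State m) :
    W m P R = (stepMatrix m P R).map (Nat.castRingHom ℂ) := by
  simp only [W, stepMatrix, Matrix.of_apply, Polynomial.map_add, Polynomial.map_sum]
  congr 1
  · refine Finset.sum_congr rfl fun k _ => ?_
    split_ifs <;> simp
  · split_ifs <;> simp

/-- The generating function of a state. -/
noncomputable def stateSeries {m : ℕ} (P : State m) : PowerSeries ℕ :=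
  endSeries m P.1.val P.2.val

/-- Every threshold produced by the recursion is a state or negative, so the indicator sums over
states lose nothing. -/
theorem stateSeries_eq {m : ℕ} (P : State m) :
    stateSeries P = PowerSeries.X +
      ∑ R, (stepMatrix m P R : PowerSeries ℕ) * stateSeries R := by
  classical
  rw [stateSeries, endSeries_eq m P.1.val_nonneg P.2.val_nonneg, add_assoc]
  congr 1
  simp only [stepMatrix, Matrix.of_apply, Polynomial.coe_add, add_mul, Finset.sum_add_distrib]
  congr 1
  · have : ∀ R : State m, ((∑ k ∈ Finset.Icc 1 m,
        if R.1.val = (((m : ℤ) - (k : ℤ) : ℤ) : WithTop ℤ) ∧ R.2.val = shift P.2.val k then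
        C (leftCoeff k P.1) * X ^ k else 0 : ℕ[X]) : PowerSeries ℕ) * stateSeries R =
        ∑ k ∈ Finset.Icc 1 m, PowerSeries.C (leftCount k P.1.val) * (PowerSeries.X ^ k *
        if R.1.val = (((m : ℤ) - (k : ℤ) : ℤ) : WithTop ℤ) ∧ R.2.val = shift P.2.val k then
        endSeries m R.1.val R.2.val else 0) := by
      intro R
      rw [← Polynomial.coeToPowerSeries.ringHom_apply, map_sum, Finset.sum_mul]
      refine Finset.sum_congr rfl fun k hk => ?_
      rw [Finset.mem_Icc] at hk
      rw [leftCoeff_eq_leftCount (by omega)]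
      split_ifs
      · rw [Polynomial.coeToPowerSeries.ringHom_apply, Polynomial.coe_mul, Polynomial.coe_C,
          Polynomial.coe_pow, Polynomial.coe_X, mul_assoc, stateSeries]
      · simp
    simp only [this]
    rw [Finset.sum_comm]
    refine Finset.sum_congr rfl fun k hk => ?_
    rw [Finset.mem_Icc] at hk
    rw [← Finset.mul_sum, ← Finset.mul_sum, sum_state_ite (endSeries m) (endSeries_eq_zero m)]
    · left
      rw [WithTop.coe_lt_coe]
      omega
    · exact shift_lt_or_eq_top _ _
  · have : ∀ R : State m, ((if R.1.val = shift P.1.val 1 ∧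
        R.2.val = (((m : ℤ) - 1 : ℤ) : WithTop ℤ) then X else 0 : ℕ[X]) : PowerSeries ℕ) *
        stateSeries R = PowerSeries.X * if R.1.val = shift P.1.val 1 ∧
        R.2.val = (((m : ℤ) - 1 : ℤ) : WithTop ℤ) then endSeries m R.1.val R.2.val else 0 := by
      intro R
      split_ifs
      · simp [stateSeries]
      · simp
    simp only [this]
    rw [← Finset.mul_sum, sum_state_ite (endSeries m) (endSeries_eq_zero m)]
    · exact shift_lt_or_eq_top _ _
    · left
      rw [WithTop.coe_lt_coe]
      omega

end BoundedAvoid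

namespace BoundedAvoid

/-! ### Polynomials with natural coefficients at real and complex points -/

section NatPolynomial

variable (p : ℕ[X])

theorem natAeval_nonneg {x : ℝ} (hx : 0 ≤ x) : 0 ≤ aeval x p := by
  rw [aeval_eq_sum_range]
  exact Finset.sum_nonneg fun i _ => nsmul_nonneg (pow_nonneg hx i) _

theorem natAeval_pos {x : ℝ} (hx : 0 < x) (hp : p ≠ 0) : 0 < aeval x p := by
  rw [aeval_eq_sum_range]
  refine Finset.sum_pos' (fun i _ => nsmul_nonneg (pow_nonneg hx.le i) _)
    ⟨p.natDegree, by simp, ?_⟩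
  exact nsmul_pos (pow_pos hx _) (by simpa using hp)

theorem natAeval_mono {x y : ℝ} (hx : 0 ≤ x) (hxy : x ≤ y) : aeval x p ≤ aeval y p := by
  rw [aeval_eq_sum_range, aeval_eq_sum_range]
  gcongr

theorem norm_natAeval_le (z : ℂ) : ‖aeval z p‖ ≤ aeval ‖z‖ p := by
  rw [aeval_eq_sum_range, aeval_eq_sum_range]
  refine (norm_sum_le _ _).trans (Finset.sum_le_sum fun i _ => ?_)
  simp

theorem natAeval_ofReal (x : ℝ) : aeval (x : ℂ) p = ((aeval x p : ℝ) : ℂ) := by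
  rw [aeval_eq_sum_range, aeval_eq_sum_range]
  simp

variable {p}

theorem natAeval_mul_le (h0 : p.coeff 0 = 0) {t x : ℝ} (ht0 : 0 ≤ t) (ht : t ≤ 1) (hx : 0 ≤ x) :
    aeval (t * x) p ≤ t * aeval x p := by
  rw [aeval_eq_sum_range, aeval_eq_sum_range, Finset.mul_sum]
  refine Finset.sum_le_sum fun i _ => ?_
  rcases i with _ | i
  · simp [h0]
  · simp only [nsmul_eq_mul, mul_pow]
    have : t ^ (i + 1) ≤ t := by
      simpa using pow_le_pow_of_le_one ht0 ht (Nat.succ_le_succ (Nat.zero_le i))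
    calc (p.coeff (i + 1) : ℝ) * (t ^ (i + 1) * x ^ (i + 1))
        ≤ (p.coeff (i + 1) : ℝ) * (t * x ^ (i + 1)) := by gcongr
      _ = t * ((p.coeff (i + 1) : ℝ) * x ^ (i + 1)) := by ring

theorem le_natAeval_mul (h0 : p.coeff 0 = 0) {t x : ℝ} (ht : 1 ≤ t) (hx : 0 ≤ x) :
    t * aeval x p ≤ aeval (t * x) p := by
  have ht0 : 0 < t := zero_lt_one.trans_le ht
  have := natAeval_mul_le h0 (inv_nonneg.2 ht0.le) (inv_le_one_of_one_le₀ ht)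
    (mul_nonneg ht0.le hx)
  rw [inv_mul_cancel_left₀ ht0.ne'] at this
  rwa [inv_mul_eq_div, le_div_iff₀' ht0] at this

/-- The value at `1` is a positive integer, hence at least `1`. -/
theorem le_natAeval (h0 : p.coeff 0 = 0) (hp : p ≠ 0) {x : ℝ} (hx : 1 ≤ x) : x ≤ aeval x p := by
  have h1 : 1 ≤ aeval (1 : ℝ) p := by
    have h2 := natAeval_pos p zero_lt_one hp
    have h3 : aeval (1 : ℝ) p = ((p.eval 1 : ℕ) : ℝ) := by
      rw [aeval_def, eval₂_eq_sum_range, eval_eq_sum_range]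
      simp
    rw [h3] at h2 ⊢
    exact_mod_cast h2
  have := le_natAeval_mul h0 hx zero_le_one
  rw [mul_one] at this
  nlinarith

end NatPolynomial

/-! ### Spectral radius and positive vectors -/

section Spectral

variable {ι : Type*} [Fintype ι]

/-- A nonzero vector touches a suitable multiple of a positive vector from below. -/
theorem exists_norm_eq_mul {u : ι → ℂ} (hu : u ≠ 0) {v : ι → ℝ} (hv : ∀ i, 0 < v i) :
    ∃ t : ℝ, 0 < t ∧ (∃ i, ‖u i‖ = t * v i) ∧ ∀ j, ‖u j‖ ≤ t * v j := by
  obtain ⟨k, hk⟩ := Function.ne_iff.1 hu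
  have : Nonempty ι := ⟨k⟩
  obtain ⟨i, hi⟩ := Finite.exists_max fun i => ‖u i‖ / v i
  refine ⟨‖u i‖ / v i, ?_, ⟨i, (div_mul_cancel₀ _ (hv i).ne').symm⟩, fun j => ?_⟩
  · exact (div_pos (norm_pos_iff.2 hk) (hv k)).trans_le (hi k)
  · exact (div_le_iff₀ (hv j)).1 (hi j)

/-- Collatz–Wielandt upper bound: compare the moduli of an eigenvector with the smallest multiple of
`v` above them, in a row where the two touch. -/
theorem spectralRadius_le_of_mulVec_le [DecidableEq ι] {B : Matrix ι ι ℂ} {A : Matrix ι ι ℝ}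
    (hBA : ∀ i j, ‖B i j‖ ≤ A i j) {v : ι → ℝ} (hv : ∀ i, 0 < v i) {c : ℝ}
    (h : ∀ i, ∑ j, A i j * v j ≤ c * v i) : spectralRadius ℂ B ≤ ENNReal.ofReal c := by
  refine iSup₂_le fun k hk => ?_
  rw [← Matrix.spectrum_toLin', ← Module.End.hasEigenvalue_iff_mem_spectrum] at hk
  obtain ⟨u, hu⟩ := hk.exists_hasEigenvector
  obtain ⟨t, ht, ⟨i, hi⟩, hle⟩ := exists_norm_eq_mul hu.2 hv
  have hrow : ∑ j, B i j * u j = k * u i := by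
    have := congrFun hu.apply_eq_smul i
    simpa [Matrix.mulVec, dotProduct] using this
  have h1 : ‖k‖ * (t * v i) ≤ c * (t * v i) := by
    rw [← hi, ← norm_mul, ← hrow, hi]
    calc ‖∑ j, B i j * u j‖ ≤ ∑ j, ‖B i j * u j‖ := norm_sum_le _ _
      _ ≤ ∑ j, A i j * (t * v j) := by
        refine Finset.sum_le_sum fun j _ => ?_
        rw [norm_mul]
        exact mul_le_mul (hBA i j) (hle j) (norm_nonneg _) ((norm_nonneg _).trans (hBA i j))
      _ = t * ∑ j, A i j * v j := by
        rw [Finset.mul_sum]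
        exact Finset.sum_congr rfl fun j _ => by ring
      _ ≤ t * (c * v i) := by gcongr; exact h i
      _ = c * (t * v i) := by ring
  have h2 : ‖k‖ ≤ c := le_of_mul_le_mul_right h1 (mul_pos ht (hv i))
  exact ENNReal.coe_le_coe.2 (NNReal.le_toNNReal_of_coe_le h2)

-- Iterating the inequality gives `Aⁿ v ≥ cⁿ v`, so `‖Aⁿ‖` is at least a constant times `cⁿ`;
-- Gelfand's formula concludes.
attribute [local instance] Matrix.linftyOpNormedRing Matrix.linftyOpNormedAlgebra in
theorem le_spectralRadius_of_le_mulVec [DecidableEq ι] [Nonempty ι] {A : Matrix ι ι ℝ} (hA : ∀ i j, 0 ≤ A i j)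
    {v : ι → ℝ} (hv : ∀ i, 0 < v i) {c : ℝ} (hc : 0 ≤ c)
    (h : ∀ i, c * v i ≤ ∑ j, A i j * v j) :
    ENNReal.ofReal c ≤ spectralRadius ℂ (A.map ((↑) : ℝ → ℂ)) := by
  set B := A.map ((↑) : ℝ → ℂ) with hB
  have hpow : ∀ n : ℕ, ∃ w : ι → ℝ, (B ^ n).mulVec (fun i => (v i : ℂ)) = (fun i => (w i : ℂ)) ∧
      ∀ i, c ^ n * v i ≤ w i := by
    intro n
    induction n with
    | zero => exact ⟨v, by simp, by simp⟩
    | succ n ih =>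
      obtain ⟨w, hw, hle⟩ := ih
      refine ⟨A.mulVec w, ?_, fun i => ?_⟩
      · rw [pow_succ', ← Matrix.mulVec_mulVec, hw]
        ext i
        simp [hB, Matrix.mulVec, dotProduct]
      · calc c ^ (n + 1) * v i = c ^ n * (c * v i) := by ring
          _ ≤ c ^ n * ∑ j, A i j * v j := by gcongr; exact h i
          _ = ∑ j, A i j * (c ^ n * v j) := by
            rw [Finset.mul_sum]
            exact Finset.sum_congr rfl fun j _ => by ring
          _ ≤ ∑ j, A i j * w j := by
            gcongr with j
            · exact hA i j
            · exact hle j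
  obtain ⟨i⟩ := ‹Nonempty ι›
  set V : ι → ℂ := fun i => (v i : ℂ) with hV
  have hVpos : 0 < ‖V‖ := by
    rw [norm_pos_iff]
    intro h0
    have := congrFun h0 i
    simp only [hV, Pi.zero_apply, Complex.ofReal_eq_zero] at this
    exact (hv i).ne' this
  set δ := v i / ‖V‖ with hδ
  have hδpos : 0 < δ := div_pos (hv i) hVpos
  have hbound : ∀ n : ℕ, c ^ n * δ ≤ ‖B ^ n‖ := by
    intro n
    obtain ⟨w, hw, hle⟩ := hpow n
    have h1 := Matrix.linfty_opNorm_mulVec (B ^ n) V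
    rw [hw] at h1
    have h2 := (norm_le_pi_norm (fun i => (w i : ℂ)) i).trans h1
    rw [hδ, ← mul_div_assoc, div_le_iff₀ hVpos]
    refine le_trans (hle i) (le_trans ?_ h2)
    simpa using le_abs_self (w i)
  have hlim := spectrum.pow_norm_pow_one_div_tendsto_nhds_spectralRadius B
  have hlim2 : Filter.Tendsto (fun n : ℕ => ENNReal.ofReal (c * δ ^ (1 / (n : ℝ))))
      Filter.atTop (nhds (ENNReal.ofReal c)) := by
    refine ENNReal.tendsto_ofReal ?_
    have : Filter.Tendsto (fun n : ℕ => δ ^ (1 / (n : ℝ))) Filter.atTop (nhds (δ ^ (0 : ℝ))) :=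
      (Real.continuous_const_rpow hδpos.ne').continuousAt.tendsto.comp
        tendsto_one_div_atTop_nhds_zero_nat
    simpa using this.const_mul c
  refine le_of_tendsto_of_tendsto hlim2 hlim ?_
  filter_upwards [Filter.eventually_ne_atTop 0] with n hn
  refine ENNReal.ofReal_le_ofReal ?_
  calc c * δ ^ (1 / (n : ℝ)) = (c ^ n * δ) ^ (1 / (n : ℝ)) := by
        rw [Real.mul_rpow (pow_nonneg hc n) hδpos.le, one_div, Real.pow_rpow_inv_natCast hc hn]
    _ ≤ ‖B ^ n‖ ^ (1 / (n : ℝ)) :=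
        Real.rpow_le_rpow (mul_nonneg (pow_nonneg hc n) hδpos.le) (hbound n) (by positivity)

end Spectral

/-! ### Strongly connected matrices of polynomials with natural coefficients -/

section Perron

variable {ι : Type*} [Fintype ι]

/-- The support graph of `M` is strongly connected, each vertex has an outgoing edge and the
entries vanish at `0`. -/
structure StronglyConnected (M : Matrix ι ι ℕ[X]) : Prop where
  coeff_zero : ∀ i j, (M i j).coeff 0 = 0
  conn : ∀ i j, Relation.ReflTransGen (fun i j => M i j ≠ 0) i j
  out : ∀ i, ∃ j, M i j ≠ 0

variable {M : Matrix ι ι ℕ[X]}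

/-- Positivity travels backwards along the edges of a path to a nonzero entry. -/
theorem StronglyConnected.pos (hM : StronglyConnected M) {x : ℝ} (hx : 0 < x) {v : ι → ℝ}
    (hv : ∀ i, 0 ≤ v i) (hne : ∃ i, v i ≠ 0) (h : ∀ i, ∑ j, aeval x (M i j) * v j ≤ v i) (i : ι) :
    0 < v i := by
  obtain ⟨k, hk⟩ := hne
  induction hM.conn i k using Relation.ReflTransGen.head_induction_on with
  | refl => exact (hv k).lt_of_ne' hk
  | head hab hbk ih =>
    rename_i a b
    refine (mul_pos (natAeval_pos _ hx hab) ih).trans_le (le_trans ?_ (h a))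
    exact Finset.single_le_sum (f := fun j => aeval x (M a j) * v j)
      (fun j _ => mul_nonneg (natAeval_nonneg _ hx.le) (hv j)) (Finset.mem_univ b)

/-- If `x > 1`, an edge out of a smallest entry of `v` has weight above `1` and breaks the
inequality. -/
theorem StronglyConnected.le_one (hM : StronglyConnected M) [Nonempty ι] {x : ℝ} (hx : 0 < x)
    {v : ι → ℝ} (hv : ∀ i, 0 < v i) (h : ∀ i, ∑ j, aeval x (M i j) * v j ≤ v i) : x ≤ 1 := by
  by_contra! hx1
  obtain ⟨i, hi⟩ := Finite.exists_min v
  obtain ⟨j, hj⟩ := hM.out i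
  have h1 : aeval x (M i j) * v j ≤ v i := le_trans
    (Finset.single_le_sum (f := fun j => aeval x (M i j) * v j)
      (fun j _ => mul_nonneg (natAeval_nonneg _ hx.le) (hv j).le) (Finset.mem_univ j)) (h i)
  have h2 := le_natAeval (hM.coeff_zero i j) hj hx1.le
  have h3 := hi j
  have h4 := hv j
  nlinarith

theorem exists_gt_of_forall_lt {x : ℝ} {w : ι → ℝ}
    (h : ∀ i, ∑ j, aeval x (M i j) * w j < w i) :
    ∃ y, x < y ∧ ∀ i, ∑ j, aeval y (M i j) * w j ≤ w i := by
  have hev : ∀ᶠ y in nhds x, ∀ i, ∑ j, aeval y (M i j) * w j < w i := by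
    rw [Filter.eventually_all]
    intro i
    have hc : Continuous fun y : ℝ => ∑ j, aeval y (M i j) * w j :=
      continuous_finsetSum _ fun j _ => (Polynomial.continuous_aeval _).mul continuous_const
    exact hc.continuousAt.eventually_lt continuousAt_const (h i)
  obtain ⟨y, hy, hxy⟩ :=
    ((hev.filter_mono nhdsWithin_le_nhds).and (self_mem_nhdsWithin (s := Set.Ioi x))).exists
  exact ⟨y, hxy, fun i => (hy i).le⟩

/-- One strict row makes all rows strict. With `d = v - A v ≥ 0` and `w = ∑_{n < T} Aⁿ v`, one has
`w - A w = ∑_{n < T} Aⁿ d`, which is positive everywhere once `T` exceeds the lengths of paths to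
the strict row. -/
theorem StronglyConnected.exists_forall_lt [DecidableEq ι] (hM : StronglyConnected M) {x : ℝ}
    (hx : 0 < x) {v : ι → ℝ} (hv : ∀ i, 0 < v i) (h : ∀ i, ∑ j, aeval x (M i j) * v j ≤ v i)
    {k : ι} (hk : ∑ j, aeval x (M k j) * v j ≠ v k) :
    ∃ w : ι → ℝ, (∀ i, 0 < w i) ∧ ∀ i, ∑ j, aeval x (M i j) * w j < w i := by
  set A : Matrix ι ι ℝ := Matrix.of fun i j => aeval x (M i j) with hA
  have hA0 : ∀ i j, 0 ≤ A i j := fun i j => natAeval_nonneg _ hx.le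
  have hstep : ∀ (n : ℕ) (d : ι → ℝ) (i : ι),
      (A ^ (n + 1)).mulVec d i = ∑ j, A i j * (A ^ n).mulVec d j := by
    intro n d i
    rw [pow_succ', ← Matrix.mulVec_mulVec]
    rfl
  have hnn : ∀ (d : ι → ℝ), (∀ i, 0 ≤ d i) → ∀ (n : ℕ) (i : ι), 0 ≤ (A ^ n).mulVec d i := by
    intro d hd n
    induction n with
    | zero => simpa using hd
    | succ n ih =>
      intro i
      rw [hstep]
      exact Finset.sum_nonneg fun j _ => mul_nonneg (hA0 i j) (ih j)
  set d : ι → ℝ := fun i => v i - ∑ j, A i j * v j with hd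
  have hd0 : ∀ i, 0 ≤ d i := fun i => sub_nonneg.2 (h i)
  have hdk : 0 < d k := (hd0 k).lt_of_ne fun h0 => hk (sub_eq_zero.1 h0.symm).symm
  have hreach : ∀ i, ∃ n, 0 < (A ^ n).mulVec d i := by
    intro i
    induction hM.conn i k using Relation.ReflTransGen.head_induction_on with
    | refl => exact ⟨0, by simpa using hdk⟩
    | head hab hbk ih =>
      rename_i a b
      obtain ⟨n, hn⟩ := ih
      refine ⟨n + 1, ?_⟩
      rw [hstep]
      refine (mul_pos (natAeval_pos _ hx hab) hn).trans_le ?_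
      exact Finset.single_le_sum (f := fun j => A a j * (A ^ n).mulVec d j)
        (fun j _ => mul_nonneg (hA0 a j) (hnn d hd0 n j)) (Finset.mem_univ b)
  choose N hN using hreach
  set T := Finset.univ.sup N + 1 with hT
  have hNT : ∀ i, N i ∈ Finset.range T := fun i => by
    rw [Finset.mem_range, hT, Nat.lt_succ_iff]
    exact Finset.le_sup (Finset.mem_univ i)
  refine ⟨fun i => ∑ n ∈ Finset.range T, (A ^ n).mulVec v i, fun i => ?_, fun i => ?_⟩
  · refine Finset.sum_pos' (fun n _ => hnn v (fun i => (hv i).le) n i)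
      ⟨0, by simp [hT], by simpa using hv i⟩
  · have hAv : A.mulVec v = v - d := by
      ext i
      simp [hd, Matrix.mulVec, dotProduct]
    have hAn : ∀ n, (A ^ (n + 1)).mulVec v = (A ^ n).mulVec v - (A ^ n).mulVec d := by
      intro n
      rw [pow_succ, ← Matrix.mulVec_mulVec, hAv, Matrix.mulVec_sub]
    have h1 : ∑ j, aeval x (M i j) * ∑ n ∈ Finset.range T, (A ^ n).mulVec v j =
        ∑ n ∈ Finset.range T, (A ^ n).mulVec v i - ∑ n ∈ Finset.range T, (A ^ n).mulVec d i := by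
      rw [← Finset.sum_sub_distrib]
      simp only [Finset.mul_sum]
      rw [Finset.sum_comm]
      refine Finset.sum_congr rfl fun n _ => ?_
      have h2 := hstep n v i
      rw [hAn] at h2
      exact h2.symm
    rw [h1, sub_lt_self_iff]
    exact Finset.sum_pos' (fun n _ => hnn d hd0 n i) ⟨N i, hNT i, hN i⟩

/-- `r` is a point at which `M` has the positive eigenvector `v` with eigenvalue `1`. -/
structure IsPerronPair (M : Matrix ι ι ℕ[X]) (r : ℝ) (v : ι → ℝ) : Prop where
  pos : 0 < r
  le_one : r ≤ 1
  vec_pos : ∀ i, 0 < v i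
  eq : ∀ i, ∑ j, aeval r (M i j) * v j = v i

/-- The largest `x` admitting a subinvariant vector `M(x) v ≤ v` in the simplex works: if some row
were strict, all rows could be made strict, and continuity would allow a larger `x`. -/
theorem StronglyConnected.exists_perronPair (hM : StronglyConnected M) [Nonempty ι] :
    ∃ r v, IsPerronPair M r v := by
  classical
  set K : Set (ℝ × (ι → ℝ)) := (Set.Icc 0 1 ×ˢ stdSimplex ℝ ι) ∩
    {a | ∀ i, ∑ j, aeval a.1 (M i j) * a.2 j ≤ a.2 i} with hK
  have hKc : IsCompact K := by
    refine (isCompact_Icc.prod (isCompact_stdSimplex ℝ ι)).inter_right ?_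
    simp only [Set.ofPred_forall]
    refine isClosed_iInter fun i => isClosed_le ?_ (by fun_prop)
    refine continuous_finsetSum _ fun j _ => Continuous.mul ?_ (by fun_prop)
    exact (Polynomial.continuous_aeval (M i j)).comp continuous_fst
  have hmem : ∀ (y : ℝ) (w : ι → ℝ), 0 < y → (∀ i, 0 < w i) →
      (∀ i, ∑ j, aeval y (M i j) * w j ≤ w i) → ∃ w', (y, w') ∈ K := by
    intro y w hy hw h
    have hs : 0 < ∑ i, w i := Finset.sum_pos (fun i _ => hw i) Finset.univ_nonempty
    refine ⟨fun i => w i / ∑ i, w i, ⟨⟨⟨hy.le, hM.le_one hy hw h⟩, ?_, ?_⟩, ?_⟩⟩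
    · exact fun i => (div_pos (hw i) hs).le
    · rw [← Finset.sum_div, div_self hs.ne']
    · intro i
      simp only [← mul_div_assoc]
      rw [← Finset.sum_div]
      gcongr
      exact h i
  -- `M(0) = 0`, so the constant vector is strictly subinvariant at `0`; this keeps the maximum away
  -- from `x = 0`.
  obtain ⟨y, hy, h⟩ := exists_gt_of_forall_lt (M := M) (x := 0) (w := fun _ => 1) (by
    intro i
    rw [Finset.sum_eq_zero]
    · exact one_pos
    · intro j _
      rw [← coeff_zero_eq_aeval_zero' , hM.coeff_zero]
      simp)
  obtain ⟨w, hw⟩ := hmem y _ hy (fun _ => one_pos) h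
  obtain ⟨⟨r, v⟩, hrv, hmax⟩ := hKc.exists_isMaxOn ⟨_, hw⟩ continuous_fst.continuousOn
  have hr : 0 < r := hy.trans_le (hmax hw)
  obtain ⟨⟨hr1, hv0, hv1⟩, hle⟩ := hrv
  have hv : ∀ i, 0 < v i := by
    refine hM.pos hr hv0 ?_ hle
    by_contra! h0
    simp [h0] at hv1
  refine ⟨r, v, hr, hr1.2, hv, fun k => ?_⟩
  by_contra hk
  obtain ⟨w, hw, hlt⟩ := hM.exists_forall_lt hr hv hle hk
  obtain ⟨y, hy, h⟩ := exists_gt_of_forall_lt hlt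
  obtain ⟨w', hw'⟩ := hmem y w (hr.trans hy) hw h
  exact absurd (hmax hw') (not_le.2 hy)

theorem IsPerronPair.lt_one {r : ℝ} {v : ι → ℝ} (h : IsPerronPair M r v) {i j : ι}
    (hij : i ≠ j) (hi : M i i = X) (hj : M i j ≠ 0) : r < 1 := by
  classical
  have h1 := h.eq i
  have h2 : ∑ k ∈ {i, j}, aeval r (M i k) * v k ≤ ∑ k, aeval r (M i k) * v k :=
    Finset.sum_le_univ_sum_of_nonneg fun k =>
      mul_nonneg (natAeval_nonneg _ h.pos.le) (h.vec_pos k).le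
  rw [Finset.sum_pair hij, h1, hi, aeval_X] at h2
  have h3 := mul_pos (natAeval_pos _ h.pos hj) (h.vec_pos j)
  have h4 := h.vec_pos i
  nlinarith

/-- With `t = x / r`, testing against `v` gives spectral radius at most `t` for `t ≤ 1` and at least
`t` for `t ≥ 1`. -/
theorem IsPerronPair.spectralRadius_eq_one_iff [DecidableEq ι] [Nonempty ι]
    (hM : ∀ i j, (M i j).coeff 0 = 0) {r : ℝ} {v : ι → ℝ} (h : IsPerronPair M r v) {x : ℝ}
    (hx : 0 < x) :
    spectralRadius ℂ (Matrix.of fun i j => aeval (x : ℂ) (M i j)) = 1 ↔ x = r := by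
  set t := x / r with ht
  have ht0 : 0 < t := div_pos hx h.pos
  have hxt : x = t * r := (div_mul_cancel₀ x h.pos.ne').symm
  set A : Matrix ι ι ℝ := Matrix.of fun i j => aeval x (M i j) with hA
  have hB : (Matrix.of fun i j => aeval (x : ℂ) (M i j)) = A.map ((↑) : ℝ → ℂ) := by
    ext i j
    simp [hA, natAeval_ofReal]
  rw [hB]
  have hupper : t ≤ 1 → spectralRadius ℂ (A.map ((↑) : ℝ → ℂ)) ≤ ENNReal.ofReal t := by
    intro ht1
    refine spectralRadius_le_of_mulVec_le (A := A) (fun i j => ?_) h.vec_pos fun i => ?_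
    · simp [hA, abs_of_nonneg (natAeval_nonneg (M i j) hx.le)]
    · rw [← h.eq i, Finset.mul_sum]
      refine Finset.sum_le_sum fun j _ => ?_
      rw [← mul_assoc]
      refine mul_le_mul_of_nonneg_right ?_ (h.vec_pos j).le
      rw [hA, Matrix.of_apply, hxt]
      exact natAeval_mul_le (hM i j) ht0.le ht1 h.pos.le
  have hlower : 1 ≤ t → ENNReal.ofReal t ≤ spectralRadius ℂ (A.map ((↑) : ℝ → ℂ)) := by
    intro ht1
    refine le_spectralRadius_of_le_mulVec (fun i j => natAeval_nonneg _ hx.le) h.vec_pos ht0.le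
      fun i => ?_
    rw [← h.eq i, Finset.mul_sum]
    refine Finset.sum_le_sum fun j _ => ?_
    rw [← mul_assoc]
    refine mul_le_mul_of_nonneg_right ?_ (h.vec_pos j).le
    rw [hxt]
    exact le_natAeval_mul (hM i j) ht1 h.pos.le
  constructor
  · intro hs
    rw [hs] at hupper hlower
    have : t = 1 := by
      rcases le_total t 1 with h1 | h1
      · exact le_antisymm h1 (by simpa using hupper h1)
      · exact le_antisymm (by simpa using hlower h1) h1
    rw [hxt, this, one_mul]
  · intro hxr
    have h1 : t = 1 := by rw [ht, hxr, div_self h.pos.ne']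
    refine le_antisymm ?_ ?_
    · simpa [h1] using hupper h1.le
    · simpa [h1] using hlower h1.ge

/-- The equality case of the triangle inequality. -/
theorem mul_norm_eq_of_sum_eq {a : ι → ℂ} {b : ι → ℝ} {s : ℂ} (hs : ∑ j, a j = s)
    (hb : ∑ j, b j = ‖s‖) (hab : ∀ j, ‖a j‖ ≤ b j) (j : ι) : a j * ‖s‖ = b j * s := by
  rcases eq_or_ne s 0 with rfl | hs0
  · simp
  -- After rotation by the conjugate of `s`, equal sums force equality in every term, so each
  -- rotated term is real and nonnegative.
  have hle : ∀ j ∈ Finset.univ, ((starRingEnd ℂ) s * a j).re ≤ ‖s‖ * b j := fun j _ => by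
    refine (Complex.re_le_norm _).trans ?_
    rw [norm_mul, RCLike.norm_conj]
    exact mul_le_mul_of_nonneg_left (hab j) (norm_nonneg s)
  have hsum : ∑ j, ((starRingEnd ℂ) s * a j).re = ∑ j, ‖s‖ * b j := by
    rw [← Complex.re_sum, ← Finset.mul_sum, ← Finset.mul_sum, hs, hb, mul_comm, Complex.mul_conj,
      Complex.ofReal_re, Complex.normSq_eq_norm_sq, sq]
  have hj := (Finset.sum_eq_sum_iff_of_le hle).1 hsum j (Finset.mem_univ j)
  have hw : (starRingEnd ℂ) s * a j = ((‖s‖ * b j : ℝ) : ℂ) := by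
    have h1 : ‖(starRingEnd ℂ) s * a j‖ ≤ ((starRingEnd ℂ) s * a j).re := by
      rw [hj, norm_mul, RCLike.norm_conj]
      exact mul_le_mul_of_nonneg_left (hab j) (norm_nonneg s)
    have h2 := Complex.re_eq_norm.1 (le_antisymm (Complex.re_le_norm _) h1)
    rw [← hj]
    refine Complex.ext rfl ?_
    simpa using (Complex.nonneg_iff.1 h2).2.symm
  have hns : (‖s‖ : ℂ) ≠ 0 := by simpa using hs0
  refine mul_left_cancel₀ hns ?_
  have h3 : s * ((starRingEnd ℂ) s * a j) = (‖s‖ : ℂ) * (a j * ‖s‖) := by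
    rw [← mul_assoc, Complex.mul_conj, Complex.normSq_eq_norm_sq]
    push_cast
    ring
  rw [← h3, hw]
  push_cast
  ring

/-- A kernel vector of `1 - M(z)` with `‖z‖ ≤ r` forces `‖z‖ = r` and the coherence of the phases
of the entries of `M(z)`. -/
theorem IsPerronPair.phases (hM : StronglyConnected M) {r : ℝ} {v : ι → ℝ}
    (h : IsPerronPair M r v) {z : ℂ} (hz : ‖z‖ ≤ r) {u : ι → ℂ} (hu : u ≠ 0)
    (heq : ∀ i, ∑ j, aeval z (M i j) * u j = u i) :
    ‖z‖ = r ∧ ∃ θ : ι → ℂ, (∀ i, θ i ≠ 0) ∧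
      ∀ i j, aeval z (M i j) * θ j = ((aeval r (M i j) : ℝ) : ℂ) * θ i := by
  classical
  obtain ⟨t, ht, ⟨i₀, hi₀⟩, hle⟩ := exists_norm_eq_mul hu h.vec_pos
  have hterm : ∀ i j, ‖aeval z (M i j) * u j‖ ≤ aeval ‖z‖ (M i j) * ‖u j‖ := fun i j => by
    rw [norm_mul]
    exact mul_le_mul_of_nonneg_right (norm_natAeval_le _ _) (norm_nonneg _)
  have hterm2 : ∀ i j, aeval ‖z‖ (M i j) * ‖u j‖ ≤ aeval r (M i j) * (t * v j) := fun i j =>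
    mul_le_mul (natAeval_mono _ (norm_nonneg z) hz) (hle j) (norm_nonneg _)
      (natAeval_nonneg _ h.pos.le)
  have hsum : ∀ i, ∑ j, aeval r (M i j) * (t * v j) = t * v i := fun i => by
    rw [← h.eq i, Finset.mul_sum]
    exact Finset.sum_congr rfl fun j _ => by ring
  have hrow : ∀ i, ‖u i‖ = t * v i → ∀ j,
      aeval ‖z‖ (M i j) * ‖u j‖ = aeval r (M i j) * (t * v j) := by
    intro i hi j
    refine (Finset.sum_eq_sum_iff_of_le fun j _ => hterm2 i j).1 ?_ j (Finset.mem_univ j)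
    refine le_antisymm (Finset.sum_le_sum fun j _ => hterm2 i j) ?_
    rw [hsum, ← hi, ← heq i]
    exact (norm_sum_le _ _).trans (Finset.sum_le_sum fun j _ => hterm i j)
  -- If `‖z‖ < r`, a nonzero entry in the touching row would drop strictly, contrary to `hrow`.
  have hzr : ‖z‖ = r := by
    refine le_antisymm hz ?_
    by_contra! hlt
    obtain ⟨j, hj⟩ := hM.out i₀
    have h1 := hrow i₀ hi₀ j
    have h2 : aeval ‖z‖ (M i₀ j) ≤ ‖z‖ / r * aeval r (M i₀ j) := by
      have := natAeval_mul_le (hM.coeff_zero i₀ j) (div_nonneg (norm_nonneg z) h.pos.le)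
        ((div_le_one h.pos).2 hz) h.pos.le
      rwa [div_mul_cancel₀ _ h.pos.ne'] at this
    have h3 : ‖z‖ / r < 1 := (div_lt_one h.pos).2 hlt
    have h4 := natAeval_pos (M i₀ j) h.pos hj
    have h5 : aeval ‖z‖ (M i₀ j) < aeval r (M i₀ j) := by nlinarith
    have h6 : aeval ‖z‖ (M i₀ j) * ‖u j‖ ≤ aeval ‖z‖ (M i₀ j) * (t * v j) :=
      mul_le_mul_of_nonneg_left (hle j) (natAeval_nonneg _ (norm_nonneg z))
    have h7 := mul_lt_mul_of_pos_right h5 (mul_pos ht (h.vec_pos j))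
    linarith
  -- Equality in one row passes to every out-neighbour, hence to all vertices.
  have hall : ∀ i, ‖u i‖ = t * v i := by
    intro i
    induction hM.conn i₀ i with
    | refl => exact hi₀
    | tail _ hbc ih =>
      have h1 := hrow _ ih
      rw [hzr] at h1
      exact mul_left_cancel₀ (natAeval_pos _ h.pos hbc).ne' (h1 _)
  refine ⟨hzr, fun i => u i / v i, fun i => ?_, fun i j => ?_⟩
  · have hv : (v i : ℂ) ≠ 0 := by exact_mod_cast (h.vec_pos i).ne'
    refine div_ne_zero ?_ hv
    rw [← norm_pos_iff, hall]
    exact mul_pos ht (h.vec_pos i)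
  · have h1 := mul_norm_eq_of_sum_eq (heq i) ((hsum i).trans (hall i).symm)
      (fun j => (hterm i j).trans (hterm2 i j)) j
    rw [hall i] at h1
    have hvi : (v i : ℂ) ≠ 0 := by exact_mod_cast (h.vec_pos i).ne'
    have hvj : (v j : ℂ) ≠ 0 := by exact_mod_cast (h.vec_pos j).ne'
    have htc : (t : ℂ) ≠ 0 := by exact_mod_cast ht.ne'
    push_cast at h1
    field_simp
    refine mul_left_cancel₀ htc ?_
    linear_combination h1

/-- Exponential lower bound for the coefficients of a system that dominates `M`. -/
theorem IsPerronPair.exists_le_coeff [Nonempty ι] (hM : ∀ i j, (M i j).coeff 0 = 0) {r : ℝ}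
    {v : ι → ℝ} (h : IsPerronPair M r v) {f : ι → PowerSeries ℕ}
    (hf : ∀ i n, ∑ j, PowerSeries.coeff n ((M i j : PowerSeries ℕ) * f j) ≤
      PowerSeries.coeff n (f i))
    (hone : ∀ i n, n ≠ 0 → 1 ≤ PowerSeries.coeff n (f i)) :
    ∃ c : ℝ, 0 < c ∧ ∀ i n, n ≠ 0 → c * v i * r⁻¹ ^ n ≤ (PowerSeries.coeff n (f i) : ℕ) := by
  classical
  obtain ⟨i₀, hi₀⟩ := Finite.exists_max v
  set d := ∑ i, ∑ j, (M i j).natDegree with hd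
  have hdeg : ∀ i j, (M i j).natDegree ≤ d := fun i j =>
    (Finset.single_le_sum (f := fun j => (M i j).natDegree) (fun _ _ => Nat.zero_le _)
      (Finset.mem_univ j)).trans
      (Finset.single_le_sum (f := fun i => ∑ j, (M i j).natDegree) (fun _ _ => Nat.zero_le _)
        (Finset.mem_univ i))
  have hr0 := h.pos
  -- This constant keeps the claimed bound at most `1` for `n ≤ d`, where coefficients are known to
  -- be at least `1`. For `n > d` the whole of each entry of `M` fits in the convolution, with
  -- strictly positive remaining index.
  have hc : 0 < r ^ d / v i₀ := div_pos (pow_pos h.pos d) (h.vec_pos i₀)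
  refine ⟨r ^ d / v i₀, hc, fun i n => ?_⟩
  induction n using Nat.strong_induction_on generalizing i with
  | _ n ih =>
    intro hn
    rcases le_or_gt n d with hnd | hnd
    · refine le_trans ?_ (Nat.one_le_cast.2 (hone i n hn))
      have h1 : r ^ d * r⁻¹ ^ n ≤ 1 := by
        rw [inv_pow, ← div_eq_mul_inv, div_le_one (pow_pos h.pos n)]
        exact pow_le_pow_of_le_one h.pos.le h.le_one hnd
      have h2 : v i / v i₀ ≤ 1 := (div_le_one (h.vec_pos i₀)).2 (hi₀ i)
      calc r ^ d / v i₀ * v i * r⁻¹ ^ n = (r ^ d * r⁻¹ ^ n) * (v i / v i₀) := by ring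
        _ ≤ 1 := mul_le_one₀ h1 (div_nonneg (h.vec_pos i).le (h.vec_pos i₀).le) h2
    · refine le_trans ?_ (Nat.cast_le.2 (hf i n))
      rw [← h.eq i, Finset.mul_sum, Finset.sum_mul, Nat.cast_sum]
      refine Finset.sum_le_sum fun j _ => ?_
      rw [PowerSeries.coeff_mul, Finset.Nat.sum_antidiagonal_eq_sum_range_succ_mk,
        aeval_eq_sum_range' (lt_of_le_of_lt (hdeg i j) (hnd.trans (Nat.lt_succ_self n))),
        Finset.sum_mul, Finset.mul_sum, Finset.sum_mul, Nat.cast_sum]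
      refine Finset.sum_le_sum fun k hk => ?_
      have hkn : k ≤ n := Nat.lt_succ_iff.1 (Finset.mem_range.1 hk)
      rw [Polynomial.coeff_coe]
      rcases eq_or_ne ((M i j).coeff k) 0 with h0 | h0
      · simp [h0]
      have hkd : k ≤ d := (le_natDegree_of_ne_zero h0).trans (hdeg i j)
      have hk0 : k ≠ 0 := by
        rintro rfl
        exact h0 (hM i j)
      have h1 := ih (n - k) (by omega) j (by omega)
      have h2 : r⁻¹ ^ (n - k) = r⁻¹ ^ n * r ^ k := by
        rw [pow_sub₀ _ (inv_ne_zero h.pos.ne') hkn, inv_pow r k, inv_inv]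
      rw [h2] at h1
      push_cast
      calc r ^ d / v i₀ * ((M i j).coeff k • r ^ k * v j) * r⁻¹ ^ n
          = ((M i j).coeff k : ℝ) * (r ^ d / v i₀ * v j * (r⁻¹ ^ n * r ^ k)) := by
            rw [nsmul_eq_mul]
            ring
        _ ≤ _ := mul_le_mul_of_nonneg_left h1 (Nat.cast_nonneg _)

end Perron

end BoundedAvoid

namespace BoundedAvoid

/-! ### Coefficients of rational power series -/

theorem exists_coeff_bound_of_geom {β : ℂ} {s : ℝ} (hβ : ‖β‖ < s) {f h : PowerSeries ℂ}
    (hfh : (1 - PowerSeries.C β * PowerSeries.X) * f = h) {K : ℝ}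
    (hK : ∀ n, ‖PowerSeries.coeff n h‖ ≤ K * s ^ n) :
    ∃ K' : ℝ, ∀ n, ‖PowerSeries.coeff n f‖ ≤ K' * s ^ n := by
  have hs : 0 < s := (norm_nonneg β).trans_lt hβ
  have hsβ : 0 < s - ‖β‖ := sub_pos.2 hβ
  have hK0 : 0 ≤ K := by
    have := (norm_nonneg _).trans (hK 0)
    simpa using this
  have hrec : ∀ n, PowerSeries.coeff (n + 1) f =
      PowerSeries.coeff (n + 1) h + β * PowerSeries.coeff n f := by
    intro n
    rw [← hfh, sub_mul, one_mul, map_sub, mul_assoc, PowerSeries.coeff_C_mul,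
      PowerSeries.coeff_succ_X_mul]
    ring
  have h0 : PowerSeries.coeff 0 f = PowerSeries.coeff 0 h := by
    rw [← hfh]
    simp [sub_mul]
  -- `K'` solves `K s + ‖β‖ K' = K' s`, so the recursion reproduces the bound.
  set K' := K * s / (s - ‖β‖) with hK'
  have hKK' : K' * (s - ‖β‖) = K * s := div_mul_cancel₀ _ hsβ.ne'
  refine ⟨K', fun n => ?_⟩
  induction n with
  | zero =>
    rw [h0]
    refine (hK 0).trans ?_
    rw [pow_zero, mul_one, mul_one, hK', le_div_iff₀ hsβ]
    nlinarith [norm_nonneg β]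
  | succ n ih =>
    rw [hrec]
    calc ‖PowerSeries.coeff (n + 1) h + β * PowerSeries.coeff n f‖
        ≤ ‖PowerSeries.coeff (n + 1) h‖ + ‖β‖ * ‖PowerSeries.coeff n f‖ :=
          (norm_add_le _ _).trans_eq (by rw [norm_mul])
      _ ≤ K * s ^ (n + 1) + ‖β‖ * (K' * s ^ n) := by
          gcongr
          exact hK (n + 1)
      _ = (K * s + ‖β‖ * K') * s ^ n := by ring
      _ = K' * s ^ (n + 1) := by
          rw [← hKK']
          ring

/-- Induction on the degree, dividing by one linear factor at a time: a factor with root `α` becomes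
`1 - α⁻¹ X` after scaling, and `‖α⁻¹‖ < s`. -/
theorem exists_coeff_bound_of_mul_eq {s : ℝ} (d : ℕ) :
    ∀ D : ℂ[X], D.natDegree = d → D ≠ 0 → (∀ α, D.IsRoot α → 1 < ‖α‖ * s) →
    ∀ f h : PowerSeries ℂ, (D : PowerSeries ℂ) * f = h →
    (∃ K : ℝ, ∀ n, ‖PowerSeries.coeff n h‖ ≤ K * s ^ n) →
    ∃ K : ℝ, ∀ n, ‖PowerSeries.coeff n f‖ ≤ K * s ^ n := by
  induction d with
  | zero =>
    rintro D hD hD0 - f h hfh ⟨K, hK⟩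
    obtain ⟨c, rfl⟩ := natDegree_eq_zero.1 hD
    have hc : c ≠ 0 := by simpa using hD0
    refine ⟨‖c‖⁻¹ * K, fun n => ?_⟩
    have h1 : PowerSeries.coeff n h = c * PowerSeries.coeff n f := by
      rw [← hfh, Polynomial.coe_C, PowerSeries.coeff_C_mul]
    have h2 := hK n
    rw [h1, norm_mul] at h2
    rw [mul_assoc, inv_mul_eq_div, le_div_iff₀' (norm_pos_iff.2 hc)]
    exact h2
  | succ d ih =>
    rintro D hD hD0 hroots f h hfh ⟨K, hK⟩
    obtain ⟨α, hα⟩ := IsAlgClosed.exists_root D (by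
      rw [degree_eq_natDegree hD0, hD]
      exact_mod_cast Nat.succ_ne_zero d)
    obtain ⟨E, rfl⟩ := dvd_iff_isRoot.2 hα
    have hE0 : E ≠ 0 := right_ne_zero_of_mul hD0
    have hα1 := hroots α hα
    have hα0 : α ≠ 0 := by
      rintro rfl
      simp at hα1
      linarith
    have hdeg : E.natDegree = d := by
      rw [natDegree_mul (X_sub_C_ne_zero α) hE0, natDegree_X_sub_C] at hD
      omega
    refine ih E hdeg hE0 (fun β hβ => hroots β ?_) f ((E : PowerSeries ℂ) * f) rfl ?_
    · simp [IsRoot, hβ.eq_zero]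
    · refine exists_coeff_bound_of_geom (β := α⁻¹) (h := PowerSeries.C (-α⁻¹) * h)
        (K := ‖α‖⁻¹ * K) ?_ ?_ fun n => ?_
      · rw [norm_inv, inv_lt_iff_one_lt_mul₀' (norm_pos_iff.2 hα0)]
        exact hα1
      · rw [← hfh, Polynomial.coe_mul, Polynomial.coe_sub, Polynomial.coe_X, Polynomial.coe_C,
          map_neg]
        have : PowerSeries.C α⁻¹ * PowerSeries.C α = (1 : PowerSeries ℂ) := by
          rw [← map_mul, inv_mul_cancel₀ hα0, map_one]
        linear_combination (-((E : PowerSeries ℂ) * f)) * this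
      · rw [PowerSeries.coeff_C_mul, norm_mul, norm_neg, norm_inv, mul_assoc]
        gcongr
        exact hK n

/-- If the roots of the denominator `D` have modulus greater than `s⁻¹`, then the coefficients of
the rational power series `N / D` are `O(s ^ n)`. -/
theorem exists_coeff_bound {s : ℝ} (hs : 0 < s) {D N : ℂ[X]} (hD : D ≠ 0)
    (hroots : ∀ α, D.IsRoot α → 1 < ‖α‖ * s) {f : PowerSeries ℂ}
    (h : (D : PowerSeries ℂ) * f = N) :
    ∃ K : ℝ, ∀ n, ‖PowerSeries.coeff n f‖ ≤ K * s ^ n := by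
  refine exists_coeff_bound_of_mul_eq _ D rfl hD hroots f N h
    ⟨∑ i ∈ Finset.range (N.natDegree + 1), ‖N.coeff i‖ / s ^ i, fun n => ?_⟩
  rw [Polynomial.coeff_coe]
  have h0 : ∀ i ∈ Finset.range (N.natDegree + 1), 0 ≤ ‖N.coeff i‖ / s ^ i := fun i _ => by
    positivity
  rcases le_or_gt n N.natDegree with hn | hn
  · rw [← div_le_iff₀ (pow_pos hs n)]
    exact Finset.single_le_sum (f := fun i => ‖N.coeff i‖ / s ^ i) h0 (by simpa using hn)
  · rw [coeff_eq_zero_of_natDegree_lt hn, norm_zero]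
    exact mul_nonneg (Finset.sum_nonneg h0) (pow_pos hs n).le

theorem exists_between_roots {D : ℂ[X]} (hD : D ≠ 0) {r : ℝ} (hr : 0 < r)
    (h : ∀ α, D.IsRoot α → r < ‖α‖) :
    ∃ s, 0 < s ∧ s < r⁻¹ ∧ ∀ α, D.IsRoot α → 1 < ‖α‖ * s := by
  classical
  obtain ⟨t, hrt, ht⟩ : ∃ t, r < t ∧ ∀ α ∈ D.roots.toFinset, t < ‖α‖ := by
    have hev : ∀ᶠ t in nhds r, ∀ α ∈ D.roots.toFinset, t < ‖α‖ := by
      rw [Filter.eventually_all_finset]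
      intro α hα
      exact eventually_lt_nhds (h α (by simpa [hD] using hα))
    obtain ⟨t, h1, h2⟩ :=
      ((hev.filter_mono nhdsWithin_le_nhds).and (self_mem_nhdsWithin (s := Set.Ioi r))).exists
    exact ⟨t, h2, h1⟩
  have ht0 : 0 < t := hr.trans hrt
  refine ⟨t⁻¹, inv_pos.2 ht0, inv_strictAnti₀ hr hrt, fun α hα => ?_⟩
  rw [← div_eq_mul_inv, one_lt_div ht0]
  exact ht α (by simpa [hD] using hα)

/-! ### Growth, radius of convergence and dominant pole -/

section Growth

variable {f : PowerSeries ℂ} {a : ℕ → ℕ} {r c : ℝ}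

theorem tendsto_rpow_of_bounds (hr : 0 < r) (hc : 0 < c)
    (hlow : ∀ n, n ≠ 0 → c * r⁻¹ ^ n ≤ a n)
    (hup : ∀ s, r⁻¹ < s → ∃ K : ℝ, ∀ n, (a n : ℝ) ≤ K * s ^ n) :
    Filter.Tendsto (fun n : ℕ => (a n : ℝ) ^ ((1 : ℝ) / (n : ℝ))) Filter.atTop (nhds r⁻¹) := by
  have hroot : ∀ (K s : ℝ), 0 < K → 0 < s → Filter.Tendsto
      (fun n : ℕ => (K * s ^ n) ^ ((1 : ℝ) / (n : ℝ))) Filter.atTop (nhds s) := by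
    intro K s hK hs
    have h1 : Filter.Tendsto (fun n : ℕ => K ^ ((1 : ℝ) / (n : ℝ)) * s) Filter.atTop
        (nhds (K ^ (0 : ℝ) * s)) :=
      (((Real.continuous_const_rpow hK.ne').continuousAt.tendsto.comp
        tendsto_one_div_atTop_nhds_zero_nat)).mul_const s
    rw [Real.rpow_zero, one_mul] at h1
    refine h1.congr' ?_
    filter_upwards [Filter.eventually_ne_atTop 0] with n hn
    rw [Real.mul_rpow hK.le (pow_nonneg hs.le n), one_div, Real.pow_rpow_inv_natCast hs.le hn]
  refine tendsto_order.2 ⟨fun y hy => ?_, fun y hy => ?_⟩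
  · have h1 := (tendsto_order.1 (hroot c r⁻¹ hc (inv_pos.2 hr))).1 y hy
    filter_upwards [h1, Filter.eventually_ne_atTop 0] with n hn hn0
    refine hn.trans_le (Real.rpow_le_rpow ?_ (hlow n hn0) (by positivity))
    have := inv_pos.2 hr
    positivity
  · obtain ⟨s, hs1, hs2⟩ := exists_between hy
    have hs : 0 < s := (inv_pos.2 hr).trans hs1
    obtain ⟨K, hK⟩ := hup s hs1
    have h1 := (tendsto_order.1 (hroot (|K| + 1) s (by positivity) hs)).2 y hs2
    filter_upwards [h1] with n hn
    refine lt_of_le_of_lt (Real.rpow_le_rpow (Nat.cast_nonneg _) ((hK n).trans ?_)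
      (by positivity)) hn
    gcongr
    linarith [le_abs_self K]

theorem radius_eq_of_bounds (hr : 0 < r) (hc : 0 < c)
    (hlow : ∀ n, n ≠ 0 → c * r⁻¹ ^ n ≤ ‖PowerSeries.coeff n f‖)
    (hup : ∀ s, r⁻¹ < s → ∃ K : ℝ, ∀ n, ‖PowerSeries.coeff n f‖ ≤ K * s ^ n) :
    radius f = ENNReal.ofReal r := by
  unfold radius
  refine le_antisymm ?_ ?_
  · refine ENNReal.le_of_forall_nnreal_lt fun t ht => ?_
    rw [ENNReal.le_ofReal_iff_toReal_le ENNReal.coe_ne_top hr.le, ENNReal.coe_toReal]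
    by_contra! hrt
    obtain ⟨K, -, hK⟩ := FormalMultilinearSeries.norm_mul_pow_le_of_lt_radius _ ht
    have h1 : 1 < (t : ℝ) / r := (one_lt_div hr).2 hrt
    obtain ⟨n, hn⟩ := pow_unbounded_of_one_lt (K / c) h1
    have h2 : ∀ n, n ≠ 0 → c * ((t : ℝ) / r) ^ n ≤ K := by
      intro n hn0
      refine le_trans ?_ (hK n)
      rw [FormalMultilinearSeries.ofScalars_norm]
      calc c * ((t : ℝ) / r) ^ n = c * r⁻¹ ^ n * (t : ℝ) ^ n := by
            rw [div_eq_inv_mul, mul_pow, mul_assoc]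
        _ ≤ _ := by
            gcongr
            exact hlow n hn0
    have h3 := h2 (n + 1) (Nat.succ_ne_zero n)
    have h4 : ((t : ℝ) / r) ^ n ≤ ((t : ℝ) / r) ^ (n + 1) :=
      pow_le_pow_right₀ h1.le (Nat.le_succ n)
    rw [div_lt_iff₀' hc] at hn
    nlinarith
  · refine ENNReal.le_of_forall_nnreal_lt fun t ht => ?_
    rcases eq_or_ne t 0 with rfl | ht0
    · simp
    have htr : (t : ℝ) < r := by
      rwa [← ENNReal.ofReal_coe_nnreal, ENNReal.ofReal_lt_ofReal_iff hr] at ht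
    have htpos : (0 : ℝ) < t := by
      exact_mod_cast pos_iff_ne_zero.2 ht0
    obtain ⟨K, hK⟩ := hup (t : ℝ)⁻¹ (inv_strictAnti₀ htpos htr)
    refine FormalMultilinearSeries.le_radius_of_bound _ K fun n => ?_
    rw [FormalMultilinearSeries.ofScalars_norm, ← le_div_iff₀ (pow_pos htpos n)]
    simpa [div_eq_mul_inv] using hK n

/-- A rational power series with coefficients at least `c r⁻ⁿ` whose denominator has no root of
modulus at most `r` other than `r` has the unique dominant pole `r`. -/
theorem isDominantPole_iff (hr : 0 < r) (hc : 0 < c)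
    (hlow : ∀ n, n ≠ 0 → c * r⁻¹ ^ n ≤ ‖PowerSeries.coeff n f‖)
    {D N : ℂ[X]} (hD : D ≠ 0) (hfD : (D : PowerSeries ℂ) * f = N)
    (hroots : ∀ z : ℂ, ‖z‖ ≤ r → D.IsRoot z → z = r) (hrad : radius f = ENNReal.ofReal r) (z : ℂ) :
    IsDominantPole f z ↔ z = (r : ℂ) := by
  have hdvd : ∀ N' D' : ℂ[X], IsCoprime N' D' → (D' : PowerSeries ℂ) * f = N' → D' ∣ D := by
    intro N' D' hco h
    have h1 : D' * N = N' * D := by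
      apply Polynomial.coe_injective ℂ
      rw [Polynomial.coe_mul, Polynomial.coe_mul, ← hfD, ← h]
      ring
    exact hco.symm.dvd_of_dvd_mul_left (h1 ▸ dvd_mul_right D' N)
  unfold IsDominantPole
  rw [hrad]
  constructor
  · rintro ⟨⟨N', D', hco, h, hz⟩, hn⟩
    have hzr : ‖z‖ = r :=
      (ENNReal.ofReal_eq_ofReal_iff (norm_nonneg z) hr.le).1 hn
    exact hroots z hzr.le (hz.dvd (hdvd N' D' hco h))
  · rintro rfl
    refine ⟨?_, by simp [abs_of_pos hr]⟩
    obtain ⟨g, N', D', hco, hN, hD'⟩ : ∃ g N' D' : ℂ[X], IsCoprime N' D' ∧ N = g * N' ∧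
        D = g * D' := by
      obtain ⟨N', hN'⟩ := EuclideanDomain.gcd_dvd_left N D
      obtain ⟨D', hD'⟩ := EuclideanDomain.gcd_dvd_right N D
      refine ⟨EuclideanDomain.gcd N D, N', D', ?_, hN', hD'⟩
      have hg : EuclideanDomain.gcd N D ≠ 0 := fun h0 => hD (by rw [hD', h0, zero_mul])
      have h1 := EuclideanDomain.gcd_eq_gcd_ab N D
      refine ⟨EuclideanDomain.gcdA N D, EuclideanDomain.gcdB N D, mul_left_cancel₀ hg ?_⟩
      calc EuclideanDomain.gcd N D * (EuclideanDomain.gcdA N D * N' +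
            EuclideanDomain.gcdB N D * D') =
            (EuclideanDomain.gcd N D * N') * EuclideanDomain.gcdA N D +
            (EuclideanDomain.gcd N D * D') * EuclideanDomain.gcdB N D := by ring
        _ = EuclideanDomain.gcd N D * 1 := by rw [← hN', ← hD', ← h1, mul_one]
    have hg : g ≠ 0 := fun h0 => hD (by rw [hD', h0, zero_mul])
    have hD'0 : D' ≠ 0 := fun h0 => hD (by rw [hD', h0, mul_zero])
    have hf : (D' : PowerSeries ℂ) * f = N' := by
      have hg' : (g : PowerSeries ℂ) ≠ 0 := by
        simpa using hg
      refine mul_left_cancel₀ hg' ?_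
      rw [← mul_assoc, ← Polynomial.coe_mul, ← Polynomial.coe_mul, ← hD', ← hN, hfD]
    refine ⟨N', D', hco, hf, ?_⟩
    -- If `r` were cancelled, all roots of `D'` would have modulus above `r`, so the coefficients
    -- would be `O(s ^ n)` with `s < r⁻¹`, against the lower bound.
    by_contra hnot
    obtain ⟨s, hs0, hsr, hs⟩ := exists_between_roots hD'0 hr fun α hα => by
      by_contra! hle
      have h1 := hroots α hle (hα.dvd (hdvd N' D' hco hf))
      exact hnot (h1 ▸ hα)
    obtain ⟨K, hK⟩ := exists_coeff_bound hs0 hD'0 hs hf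
    have h1 : 1 < r⁻¹ / s := (one_lt_div hs0).2 hsr
    obtain ⟨n, hn⟩ := pow_unbounded_of_one_lt (K / c) h1
    have h2 : ((r⁻¹ / s) ^ n : ℝ) ≤ (r⁻¹ / s) ^ (n + 1) := pow_le_pow_right₀ h1.le (Nat.le_succ n)
    have h3 := (hlow (n + 1) (Nat.succ_ne_zero n)).trans (hK (n + 1))
    rw [← div_le_iff₀ (pow_pos hs0 _), mul_div_assoc, ← div_pow] at h3
    rw [div_lt_iff₀' hc] at hn
    nlinarith

end Growth

end BoundedAvoid

namespace BoundedAvoid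

/-! ### Entries of the step matrix -/

section Entries

variable {m : ℕ}

theorem coe_int_inj {a b : ℤ} : ((a : ℤ) : WithTop ℤ) = b ↔ a = b := WithTop.coe_inj

theorem stepMatrix_cases {P R : State m} (h : stepMatrix m P R ≠ 0) :
    (∃ k, 1 ≤ k ∧ k ≤ m ∧ R.1.val = (((m : ℤ) - (k : ℤ) : ℤ) : WithTop ℤ) ∧
      R.2.val = shift P.2.val k) ∨
    (R.1.val = shift P.1.val 1 ∧ R.2.val = (((m : ℤ) - 1 : ℤ) : WithTop ℤ)) := by
  classical
  by_contra! hno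
  refine h ?_
  rw [stepMatrix, Matrix.of_apply, if_neg fun h' => hno.2 h'.1 h'.2, add_zero]
  refine Finset.sum_eq_zero fun k hk => ?_
  rw [Finset.mem_Icc] at hk
  exact if_neg fun h' => hno.1 k hk.1 hk.2 h'.1 h'.2

theorem stepMatrix_coeff_zero (P R : State m) : (stepMatrix m P R).coeff 0 = 0 := by
  classical
  rw [stepMatrix, Matrix.of_apply, coeff_add, finsetSum_coeff, Finset.sum_eq_zero]
  · split_ifs <;> simp
  · intro k hk
    rw [Finset.mem_Icc] at hk
    split_ifs
    · rw [coeff_C_mul, coeff_X_pow, if_neg (by omega), mul_zero]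
    · simp

theorem leftCoeff_le_coeff {P R : State m} {k : ℕ} (hk : 1 ≤ k) (hkm : k ≤ m)
    (h1 : R.1.val = (((m : ℤ) - (k : ℤ) : ℤ) : WithTop ℤ)) (h2 : R.2.val = shift P.2.val k) :
    leftCoeff k P.1 ≤ (stepMatrix m P R).coeff k := by
  classical
  rw [stepMatrix, Matrix.of_apply, coeff_add, finsetSum_coeff]
  refine le_add_right (le_trans (le_of_eq ?_)
    (Finset.single_le_sum (fun _ _ => Nat.zero_le _) (Finset.mem_Icc.2 ⟨hk, hkm⟩)))
  rw [if_pos ⟨h1, h2⟩]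
  simp

theorem one_le_coeff_of_first (hm : 1 ≤ m) {P R : State m}
    (h1 : R.1.val = (((m : ℤ) - 1 : ℤ) : WithTop ℤ)) (h2 : R.2.val = shift P.2.val 1) :
    1 ≤ (stepMatrix m P R).coeff 1 := by
  simpa [leftCoeff] using leftCoeff_le_coeff (P := P) (R := R) le_rfl hm (by simpa using h1) h2

theorem ne_zero_of_one_le_coeff {p : ℕ[X]} (h : 1 ≤ p.coeff 1) : p ≠ 0 := by
  rintro rfl
  simp at h

theorem leftCount_pos {k : ℕ} {a : WithTop ℤ} (h : k = 1 ∨ 1 ≤ a) : 0 < leftCount k a := by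
  classical
  rw [leftCount, Finset.card_pos]
  by_cases hk : k ≤ 1
  · refine ⟨.nil, ?_⟩
    simp
    omega
  · have ha := h.resolve_left (by omega)
    have hne : (BinaryTree.treesOfNumNodesEq (k - 2)).Nonempty := by
      rw [← Finset.card_pos, BinaryTree.treesOfNumNodesEq_card_eq_catalan, catalan_eq_centralBinom_div]
      exact Nat.div_pos (Nat.le_of_dvd (Nat.centralBinom_pos _) (Nat.succ_dvd_centralBinom _))
        (Nat.succ_pos _)
    obtain ⟨t, ht⟩ := hne
    -- With no left subtree the maximum stands first, so the head deficit is `0`, within any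
    -- threshold at least `1`.
    refine ⟨.node () .nil t, ?_⟩
    rw [BinaryTree.mem_treesOfNumNodesEq] at ht
    simp [headDef, ht, ha]
    omega

theorem stepMatrix_ne_zero {P R : State m} {k : ℕ} (hk : 1 ≤ k) (hkm : k ≤ m)
    (h1 : R.1.val = (((m : ℤ) - (k : ℤ) : ℤ) : WithTop ℤ)) (h2 : R.2.val = shift P.2.val k)
    (hP : k = 1 ∨ 1 ≤ P.1.val) : stepMatrix m P R ≠ 0 := by
  intro h0
  have h3 := leftCoeff_le_coeff hk hkm h1 h2
  rw [h0, leftCoeff_eq_leftCount (by omega)] at h3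
  have h4 := leftCount_pos hP
  simp at h3
  omega

theorem stepMatrix_eq_X_of_first (hm : 1 ≤ m) {P R : State m}
    (h1 : R.1.val = (((m : ℤ) - 1 : ℤ) : WithTop ℤ)) (h2 : R.2.val = shift P.2.val 1)
    (h3 : R.2.val ≠ (((m : ℤ) - 1 : ℤ) : WithTop ℤ)) : stepMatrix m P R = X := by
  classical
  rw [stepMatrix, Matrix.of_apply, if_neg fun h' => h3 h'.2, add_zero, Finset.sum_eq_single 1]
  · rw [if_pos ⟨by simpa using h1, h2⟩]
    simp [leftCoeff]
  · intro k _ hk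
    refine if_neg fun h' => hk ?_
    rw [h1] at h'
    have := WithTop.coe_inj.1 h'.1
    omega
  · intro h
    simp [hm] at h

theorem stepMatrix_eq_X_of_last {P R : State m} (h1 : R.1.val = shift P.1.val 1)
    (h2 : R.2.val = (((m : ℤ) - 1 : ℤ) : WithTop ℤ)) (h3 : P.2 ≠ ⊤) : stepMatrix m P R = X := by
  classical
  rw [stepMatrix, Matrix.of_apply, if_pos ⟨h1, h2⟩, Finset.sum_eq_zero, zero_add]
  intro k hk
  rw [Finset.mem_Icc] at hk
  refine if_neg fun h' => ?_
  obtain ⟨j, hj⟩ := WithTop.ne_top_iff_exists.1 h3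
  rw [h2, ← hj, Threshold.val_coe, shift_coe] at h'
  have := WithTop.coe_inj.1 h'.2
  have := j.isLt
  omega

end Entries

/-! ### The components -/

section Components

variable {m : ℕ}

/-- The principal submatrix of `stepMatrix m`. -/
noncomputable def subMatrix (S : Finset (State m)) : Matrix S S ℕ[X] :=
  Matrix.of fun P R => stepMatrix m P.1 R.1

theorem spr_eq (S : Finset (State m)) (x : ℝ) :
    spr S x = spectralRadius ℂ (Matrix.of fun P R => aeval (x : ℂ) (subMatrix S P R)) := by
  unfold spr
  congr 1
  ext P R
  simp only [componentMatrix, Matrix.of_apply, W_apply, eval_map, subMatrix]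
  rfl

theorem isComponentRadius_of_perronPair {S : Finset (State m)} [Nonempty S] {r : ℝ} {v : S → ℝ}
    (h : IsPerronPair (subMatrix S) r v) : IsComponentRadius S r := by
  refine ⟨h.pos, h.le_one, fun x hx => ?_⟩
  rw [spr_eq]
  exact h.spectralRadius_eq_one_iff (fun P R => stepMatrix_coeff_zero _ _) hx

/-- The state with two finite thresholds. -/
def finState (i j : Fin m) : State m := ((i : Threshold m), (j : Threshold m))

/-- The state with one finite threshold. -/
def topState (i : Fin m) : State m := ((i : Threshold m), ⊤)

theorem mem_compU {P : State m} : P ∈ compU m ↔ ∃ i, P = topState i := by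
  simp [compU, topState, eq_comm]

theorem mem_compV {P : State m} : P ∈ compV m ↔ ∃ i j : Fin m, P = finState i j ∧
    ((j : ℕ) < i ∨ ((i : ℕ) + 2 ≤ m ∧ (j : ℕ) + 1 = m)) := by
  simp only [compV, Finset.mem_image, Finset.mem_filter, Finset.mem_univ, true_and, Prod.exists,
    finState, Fin.lt_def]
  exact exists_congr fun i => exists_congr fun j => by rw [and_comm, eq_comm]

theorem state_cases (P : State m) : (∃ i j, P = finState i j) ∨ (∃ i, P = topState i) ∨
    (∃ j : Fin m, P = (⊤, (j : Threshold m))) ∨ P = (⊤, ⊤) := by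
  obtain ⟨p, q⟩ := P
  induction p using WithTop.recTopCoe <;> induction q using WithTop.recTopCoe <;>
    simp [finState, topState]

/-- This and the next three lemmas give the triangular structure: two finite thresholds lead only
into `V`, `U` leads to `U` or `V`, and an infinite first threshold leads to a component or to `(⊤, m
- 1)`. -/
theorem mem_compV_of_finState {i j : Fin m} {R : State m}
    (h : stepMatrix m (finState i j) R ≠ 0) : R ∈ compV m := by
  rw [mem_compV]
  rcases state_cases R with ⟨a, b, rfl⟩ | ⟨a, rfl⟩ | ⟨b, rfl⟩ | rfl <;>
    rcases stepMatrix_cases h with ⟨k, hk1, hkm, h1, h2⟩ | ⟨h1, h2⟩ <;>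
    simp only [finState, topState, Threshold.val_coe, Threshold.val_top, shift_coe,
      WithTop.top_ne_coe, coe_int_inj] at h1 h2
  · exact ⟨a, b, rfl, by omega⟩
  · exact ⟨a, b, rfl, by omega⟩

theorem mem_of_topState {i : Fin m} {R : State m} (h : stepMatrix m (topState i) R ≠ 0) :
    R ∈ compU m ∨ R ∈ compV m := by
  rw [mem_compU, mem_compV]
  rcases state_cases R with ⟨a, b, rfl⟩ | ⟨a, rfl⟩ | ⟨b, rfl⟩ | rfl
  · rcases stepMatrix_cases h with ⟨k, hk1, hkm, h1, h2⟩ | ⟨h1, h2⟩ <;>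
      simp only [finState, topState, Threshold.val_coe, Threshold.val_top, shift_coe, shift_top,
        WithTop.coe_ne_top, coe_int_inj] at h1 h2
    exact Or.inr ⟨a, b, rfl, by omega⟩
  · exact Or.inl ⟨a, rfl⟩
  all_goals
    rcases stepMatrix_cases h with ⟨k, hk1, hkm, h1, h2⟩ | ⟨h1, h2⟩ <;>
      simp only [topState, Threshold.val_coe, Threshold.val_top, shift_coe,
        WithTop.top_ne_coe] at h1 h2

theorem mem_of_top_coe {j : Fin m} {R : State m}
    (h : stepMatrix m (⊤, (j : Threshold m)) R ≠ 0) :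
    R ∈ compV m ∨ ∃ l : Fin m, (l : ℕ) + 1 = m ∧ R = (⊤, (l : Threshold m)) := by
  rw [mem_compV]
  rcases state_cases R with ⟨a, b, rfl⟩ | ⟨a, rfl⟩ | ⟨b, rfl⟩ | rfl <;>
    rcases stepMatrix_cases h with ⟨k, hk1, hkm, h1, h2⟩ | ⟨h1, h2⟩ <;>
    simp only [finState, topState, Threshold.val_coe, Threshold.val_top, shift_coe, shift_top,
      WithTop.top_ne_coe, WithTop.coe_ne_top, coe_int_inj] at h1 h2
  · exact Or.inl ⟨a, b, rfl, by omega⟩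
  · exact Or.inr ⟨b, by omega, rfl⟩

theorem mem_of_top_top {R : State m} (h : stepMatrix m (⊤, ⊤) R ≠ 0) :
    R ∈ compU m ∨ ∃ l : Fin m, (l : ℕ) + 1 = m ∧ R = (⊤, (l : Threshold m)) := by
  rw [mem_compU]
  rcases state_cases R with ⟨a, b, rfl⟩ | ⟨a, rfl⟩ | ⟨b, rfl⟩ | rfl <;>
    rcases stepMatrix_cases h with ⟨k, hk1, hkm, h1, h2⟩ | ⟨h1, h2⟩ <;>
    simp only [finState, topState, Threshold.val_coe, Threshold.val_top, shift_top,
      WithTop.top_ne_coe, WithTop.coe_ne_top, coe_int_inj] at h1 h2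
  · exact Or.inl ⟨a, rfl⟩
  · exact Or.inr ⟨b, by omega, rfl⟩

/-! #### The component `U` -/

theorem topState_first (hm : 1 ≤ m) (i : Fin m) {l : Fin m} (hl : (l : ℕ) + 1 = m) :
    1 ≤ (stepMatrix m (topState i) (topState l)).coeff 1 := by
  refine one_le_coeff_of_first hm ?_ rfl
  simp only [topState, Threshold.val_coe, coe_int_inj]
  omega

theorem topState_edge (i : Fin m) {l : Fin m} (hl : (l : ℕ) + 1 = m) :
    stepMatrix m (topState l) (topState i) ≠ 0 := by
  have := i.isLt
  refine stepMatrix_ne_zero (k := m - i) (by omega) (by omega) ?_ rfl ?_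
  · simp only [topState, Threshold.val_coe, coe_int_inj]
    omega
  · by_cases h : m = 1
    · left
      omega
    · right
      simp only [topState, Threshold.val_coe, ← WithTop.coe_one, WithTop.coe_le_coe]
      omega

theorem topState_loop (hm : 1 ≤ m) {l : Fin m} (hl : (l : ℕ) + 1 = m) :
    stepMatrix m (topState l) (topState l) = X := by
  refine stepMatrix_eq_X_of_first hm ?_ rfl ?_
  · simp only [topState, Threshold.val_coe, coe_int_inj]
    omega
  · exact WithTop.top_ne_coe

/-- The state `(m - 1, ∞)` is a hub, with edges from and to every state of `U`. -/
theorem stronglyConnected_compU (hm : 1 ≤ m) : StronglyConnected (subMatrix (compU m)) := by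
  set l : Fin m := ⟨m - 1, by omega⟩ with hl
  have hl' : (l : ℕ) + 1 = m := by simp [hl]; omega
  set L : compU m := ⟨topState l, mem_compU.2 ⟨l, rfl⟩⟩ with hL
  have hto : ∀ P : compU m, subMatrix (compU m) P L ≠ 0 := by
    rintro ⟨P, hP⟩
    obtain ⟨i, rfl⟩ := mem_compU.1 hP
    exact ne_zero_of_one_le_coeff (topState_first hm i hl')
  have hfrom : ∀ P : compU m, subMatrix (compU m) L P ≠ 0 := by
    rintro ⟨P, hP⟩
    obtain ⟨i, rfl⟩ := mem_compU.1 hP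
    exact topState_edge i hl'
  exact ⟨fun P R => stepMatrix_coeff_zero _ _,
    fun P R => .head (hto P) (.single (hfrom R)), fun P => ⟨L, hto P⟩⟩

/-! #### The component `V` -/

/-- A state of the component `V`. -/
def vState (i j : ℕ) (hi : i < m) (hj : j < m) (h : j < i ∨ (i + 2 ≤ m ∧ j + 1 = m)) : compV m :=
  ⟨finState ⟨i, hi⟩ ⟨j, hj⟩, mem_compV.2 ⟨_, _, rfl, h⟩⟩

theorem exists_vState (P : compV m) : ∃ i j hi hj h, P = vState i j hi hj h := by
  obtain ⟨P, hP⟩ := P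
  obtain ⟨i, j, rfl, h⟩ := mem_compV.1 hP
  exact ⟨i, j, i.isLt, j.isLt, h, rfl⟩

section VEntries

variable {i j i' j' : ℕ} {hi : i < m} {hj : j < m} {h : j < i ∨ (i + 2 ≤ m ∧ j + 1 = m)}
  {hi' : i' < m} {hj' : j' < m} {h' : j' < i' ∨ (i' + 2 ≤ m ∧ j' + 1 = m)}

theorem vState_first (h1 : i' + 1 = m) (h2 : j' + 1 = j) :
    subMatrix (compV m) (vState i j hi hj h) (vState i' j' hi' hj' h') = X := by
  refine stepMatrix_eq_X_of_first (by omega) ?_ ?_ ?_ <;>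
    simp only [vState, finState, Threshold.val_coe, shift_coe, coe_int_inj, ne_eq] <;> omega

theorem vState_last (h1 : i' + 1 = i) (h2 : j' + 1 = m) :
    subMatrix (compV m) (vState i j hi hj h) (vState i' j' hi' hj' h') = X := by
  refine stepMatrix_eq_X_of_last ?_ ?_ ?_ <;>
    simp only [vState, finState, Threshold.val_coe, shift_coe, coe_int_inj, ne_eq,
      WithTop.coe_ne_top, not_false_eq_true] <;> omega

theorem vState_edge {k : ℕ} (hk : 1 ≤ k) (h1 : i' + k = m) (h2 : j' + k = j) (h3 : 1 ≤ i) :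
    subMatrix (compV m) (vState i j hi hj h) (vState i' j' hi' hj' h') ≠ 0 := by
  refine stepMatrix_ne_zero hk (by omega) ?_ ?_ (Or.inr ?_)
  · simp only [vState, finState, Threshold.val_coe, coe_int_inj]
    omega
  · simp only [vState, finState, Threshold.val_coe, shift_coe, coe_int_inj]
    omega
  · simp only [vState, finState, Threshold.val_coe, ← WithTop.coe_one, WithTop.coe_le_coe]
    omega

end VEntries

/-- Every state of `V` has an outgoing edge of weight `x`. -/
theorem exists_edge_compV (P : compV m) : ∃ R, subMatrix (compV m) P R = X := by
  obtain ⟨i, j, hi, hj, h, rfl⟩ := exists_vState P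
  rcases h with h | ⟨h1, h2⟩
  · exact ⟨vState (i - 1) (m - 1) (by omega) (by omega) (by omega),
      vState_last (by omega) (by omega)⟩
  · exact ⟨vState (m - 1) (m - 2) (by omega) (by omega) (by omega),
      vState_first (by omega) (by omega)⟩

theorem stronglyConnected_compV (hm : 2 ≤ m) : StronglyConnected (subMatrix (compV m)) := by
  set hub : compV m := vState (m - 1) (m - 2) (by omega) (by omega) (by omega) with hhub
  have hX : ∀ {P R : compV m}, subMatrix (compV m) P R = X → subMatrix (compV m) P R ≠ 0 :=
    fun h0 => h0 ▸ X_ne_zero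
  have hto : ∀ P : compV m,
      Relation.ReflTransGen (fun P R => subMatrix (compV m) P R ≠ 0) P hub := by
    intro P
    have hlast : ∀ i (hi : i + 2 ≤ m), subMatrix (compV m)
        (vState i (m - 1) (by omega) (by omega) (by omega)) hub = X := fun i hi =>
      vState_first (by omega) (by omega)
    obtain ⟨i, j, hi, hj, h, rfl⟩ := exists_vState P
    rcases h with h | ⟨h1, h2⟩
    · refine .head (hX (vState_last (i' := i - 1) (j' := m - 1) (hi' := by omega)
        (hj' := by omega) (h' := by omega) (by omega) (by omega)))
        (.single (hX (hlast (i - 1) (by omega))))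
    · obtain rfl : j = m - 1 := by omega
      exact .single (hX (hlast i h1))
  have hrow : ∀ d (hd : d + 2 ≤ m),
      Relation.ReflTransGen (fun P R => subMatrix (compV m) P R ≠ 0) hub
        (vState (m - 1) (m - 2 - d) (by omega) (by omega) (by omega)) := by
    intro d
    induction d with
    | zero => exact fun _ => .refl
    | succ d ih =>
      exact fun hd => (ih (by omega)).tail (hX (vState_first (by omega) (by omega)))
  have hcol : ∀ d (hd : d + 2 ≤ m),
      Relation.ReflTransGen (fun P R => subMatrix (compV m) P R ≠ 0) hub
        (vState (m - 2 - d) (m - 1) (by omega) (by omega) (by omega)) := by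
    intro d
    induction d with
    | zero => exact fun _ => .single (hX (vState_last (by omega) (by omega)))
    | succ d ih =>
      exact fun hd => (ih (by omega)).tail (hX (vState_last (by omega) (by omega)))
  -- A state `(i, j)` with `j < i` is entered by the step `k = m - i` from a state with second
  -- threshold `j + k`. That state lies in row `m - 1`, unless `j + 1 = i`; then `j + k = m - 1` and
  -- column `m - 1` supplies it.
  have hfrom : ∀ R : compV m,
      Relation.ReflTransGen (fun P R => subMatrix (compV m) P R ≠ 0) hub R := by
    intro R
    obtain ⟨i, j, hi, hj, h, rfl⟩ := exists_vState R
    rcases h with h | ⟨h1, h2⟩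
    · by_cases hij : j + 1 = i
      · by_cases him : i + 1 = m
        · obtain rfl : i = m - 1 := by omega
          obtain rfl : j = m - 2 := by omega
          exact .refl
        · exact (hcol 0 (by omega)).tail
            (vState_edge (k := m - i) (by omega) (by omega) (by omega) (by omega))
      · exact (hrow (m - 2 - (j + (m - i))) (by omega)).tail
          (vState_edge (k := m - i) (by omega) (by omega) (by omega) (by omega))
    · obtain ⟨d, hd, rfl⟩ : ∃ d, d + 2 ≤ m ∧ i = m - 2 - d := ⟨m - 2 - i, by omega, by omega⟩
      obtain rfl : j = m - 1 := by omega
      exact hcol d hd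
  exact ⟨fun P R => stepMatrix_coeff_zero _ _, fun P R => (hto P).trans (hfrom R),
    fun P => (exists_edge_compV P).imp fun R h => hX h⟩

end Components

end BoundedAvoid

namespace BoundedAvoid

section Main

variable {m : ℕ}

/-! ### The denominator -/

theorem sum_subtype_eq {S : Finset (State m)} {g : State m → ℂ} (hg : ∀ R, R ∉ S → g R = 0) :
    ∑ R : S, g R = ∑ R, g R := by
  rw [Finset.sum_coe_sort S g]
  exact Finset.sum_subset (Finset.subset_univ S) fun R _ hR => hg R hR

/-- If the two components have no kernel vector at `z ≠ 1`, the whole system has none. -/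
theorem kernel_eq_zero {z : ℂ} (hz : z ≠ 1)
    (hU : ∀ u : compU m → ℂ, (∀ P, ∑ R, aeval z (subMatrix (compU m) P R) * u R = u P) → u = 0)
    (hV : ∀ u : compV m → ℂ, (∀ P, ∑ R, aeval z (subMatrix (compV m) P R) * u R = u P) → u = 0)
    {u : State m → ℂ} (hu : ∀ P, ∑ R, aeval z (stepMatrix m P R) * u R = u P) : u = 0 := by
  have hrow : ∀ P, (∀ R, stepMatrix m P R ≠ 0 → u R = 0) → u P = 0 := by
    intro P h
    rw [← hu P]
    refine Finset.sum_eq_zero fun R _ => ?_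
    by_cases h0 : stepMatrix m P R = 0
    · rw [h0, map_zero, zero_mul]
    · rw [h R h0, mul_zero]
  have huV : ∀ P ∈ compV m, u P = 0 := by
    have := hV (fun P => u P) fun P => by
      rw [← hu P]
      refine sum_subtype_eq (g := fun R => aeval z (stepMatrix m P R) * u R) fun R hR => ?_
      obtain ⟨i, j, hP, -⟩ := mem_compV.1 P.2
      by_cases h0 : stepMatrix m P R = 0
      · rw [h0, map_zero, zero_mul]
      · rw [hP] at h0
        exact absurd (mem_compV_of_finState h0) hR
    exact fun P hP => congrFun this ⟨P, hP⟩
  have huF : ∀ i j, u (finState i j) = 0 := fun i j =>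
    hrow _ fun R hR => huV R (mem_compV_of_finState hR)
  have huU : ∀ P ∈ compU m, u P = 0 := by
    have := hU (fun P => u P) fun P => by
      rw [← hu P]
      refine sum_subtype_eq (g := fun R => aeval z (stepMatrix m P R) * u R) fun R hR => ?_
      obtain ⟨i, hP⟩ := mem_compU.1 P.2
      by_cases h0 : stepMatrix m P R = 0
      · rw [h0, map_zero, zero_mul]
      · rw [hP] at h0
        rw [huV R ((mem_of_topState h0).resolve_left hR), mul_zero]
    exact fun P hP => congrFun this ⟨P, hP⟩
  have hlast : ∀ l : Fin m, (l : ℕ) + 1 = m → u (⊤, (l : Threshold m)) = 0 := by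
    intro l hl
    have h1 := hu (⊤, (l : Threshold m))
    rw [Finset.sum_eq_single (⊤, (l : Threshold m))] at h1
    · rw [stepMatrix_eq_X_of_last rfl _ WithTop.coe_ne_top, aeval_X] at h1
      · have h2 : (z - 1) * u (⊤, (l : Threshold m)) = 0 := by
          rw [sub_mul, one_mul, h1, sub_self]
        exact (mul_eq_zero.1 h2).resolve_left (sub_ne_zero.2 hz)
      · simp only [Threshold.val_coe, coe_int_inj]
        omega
    · intro R _ hR
      by_cases h0 : stepMatrix m (⊤, (l : Threshold m)) R = 0
      · rw [h0, map_zero, zero_mul]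
      · rcases mem_of_top_coe h0 with h | ⟨l', hl', rfl⟩
        · rw [huV R h, mul_zero]
        · obtain rfl : l' = l := Fin.ext (by omega)
          exact absurd rfl hR
    · simp
  ext P
  rcases state_cases P with ⟨i, j, rfl⟩ | ⟨i, rfl⟩ | ⟨j, rfl⟩ | rfl
  · exact huF i j
  · exact huU _ (mem_compU.2 ⟨i, rfl⟩)
  · refine hrow _ fun R hR => ?_
    rcases mem_of_top_coe hR with h | ⟨l, hl, rfl⟩
    · exact huV R h
    · exact hlast l hl
  · refine hrow _ fun R hR => ?_
    rcases mem_of_top_top hR with h | ⟨l, hl, rfl⟩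
    · exact huU R h
    · exact hlast l hl

/-- The determinant of the endpoint-state system. -/
noncomputable def denom (m : ℕ) : ℂ[X] := (1 - W m).det

theorem denom_eval (z : ℂ) : (denom m).eval z =
    (1 - Matrix.of fun P R => aeval z (stepMatrix m P R) : Matrix (State m) (State m) ℂ).det := by
  rw [denom, ← coe_evalRingHom, RingHom.map_det, RingHom.map_sub, map_one]
  congr 2
  ext P R
  simp only [RingHom.mapMatrix_apply, Matrix.map_apply, W_apply, coe_evalRingHom, eval_map]
  rfl

theorem denom_ne_zero : denom m ≠ 0 := by
  intro h
  have h1 := denom_eval (m := m) 0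
  have h2 : (Matrix.of fun P R => aeval (0 : ℂ) (stepMatrix m P R) :
      Matrix (State m) (State m) ℂ) = 0 := by
    ext P R
    rw [Matrix.of_apply, ← coeff_zero_eq_aeval_zero', stepMatrix_coeff_zero]
    simp
  rw [h, h2] at h1
  simp at h1

theorem exists_kernel_of_isRoot {z : ℂ} (hz : (denom m).IsRoot z) :
    ∃ u : State m → ℂ, u ≠ 0 ∧ ∀ P, ∑ R, aeval z (stepMatrix m P R) * u R = u P := by
  rw [IsRoot, denom_eval] at hz
  obtain ⟨u, hu, h⟩ := Matrix.exists_mulVec_eq_zero_iff.2 hz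
  refine ⟨u, hu, fun P => ?_⟩
  rw [Matrix.sub_mulVec, Matrix.one_mulVec, sub_eq_zero] at h
  exact (congrFun h P).symm

theorem count_zero (m : ℕ) : count m 0 = 1 := by
  classical
  rw [count_eq_card_tree]
  simp [Finset.filter_singleton, TreeBdd]

theorem genFun_eq (m : ℕ) : genFun m =
    1 + (stateSeries ((⊤, ⊤) : State m)).map (Nat.castRingHom ℂ) := by
  ext n
  rw [genFun, PowerSeries.coeff_mk, map_add, PowerSeries.coeff_map, PowerSeries.coeff_one,
    stateSeries, endSeries, PowerSeries.coeff_mk]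
  by_cases hn : n = 0
  · simp [hn, count_zero, endCount_zero]
  · simp [hn, count_eq_endCount m n hn]

/-- The generating function is rational with denominator `denom m`. -/
theorem exists_denom_mul_genFun (m : ℕ) :
    ∃ N : ℂ[X], (denom m : PowerSeries ℂ) * genFun m = N := by
  set φ : ℂ[X] →+* PowerSeries ℂ := Polynomial.coeToPowerSeries.ringHom with hφ
  set A : Matrix (State m) (State m) ℂ[X] := 1 - W m with hA
  set F : State m → PowerSeries ℂ := fun P => (stateSeries P).map (Nat.castRingHom ℂ) with hF
  have hsys : (φ.mapMatrix A).mulVec F = fun _ => φ X := by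
    ext1 P
    have h1 := congrArg (PowerSeries.map (Nat.castRingHom ℂ)) (stateSeries_eq P)
    simp only [map_add, map_sum, map_mul, PowerSeries.map_X] at h1
    rw [hA, map_sub, map_one, Matrix.sub_mulVec, Matrix.one_mulVec, Pi.sub_apply, sub_eq_iff_eq_add]
    refine h1.trans ?_
    simp only [hφ, Polynomial.coeToPowerSeries.ringHom_apply, Polynomial.coe_X]
    congr 1
    refine Finset.sum_congr rfl fun R _ => ?_
    congr 1
    change _ = (W m P R : PowerSeries ℂ)
    rw [W_apply]
    ext n
    simp
  -- Cramer's rule: multiply the system by the adjugate.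
  have hdet : ∀ P, φ (denom m) * F P = φ (∑ R, A.adjugate P R * X) := by
    intro P
    have h1 := congrArg (fun v => (φ.mapMatrix A.adjugate).mulVec v P) hsys
    simp only [Matrix.mulVec_mulVec, ← map_mul, Matrix.adjugate_mul] at h1
    rw [map_sum]
    simp only [map_mul]
    refine Eq.trans ?_ h1
    rw [denom, ← hA]
    have h2 : φ.mapMatrix (A.det • (1 : Matrix (State m) (State m) ℂ[X])) =
        φ A.det • (1 : Matrix (State m) (State m) (PowerSeries ℂ)) := by
      ext Q R
      simp [Matrix.one_apply, apply_ite φ]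
    rw [h2, Matrix.smul_mulVec, Matrix.one_mulVec, Pi.smul_apply, smul_eq_mul]
  refine ⟨denom m + ∑ R, A.adjugate (⊤, ⊤) R * X, ?_⟩
  rw [genFun_eq, mul_add, mul_one, Polynomial.coe_add]
  congr 1
  exact hdet (⊤, ⊤)

/-! ### Lower bounds -/

theorem sum_coeff_le (S : Finset (State m)) (P : S) (n : ℕ) :
    ∑ R : S, PowerSeries.coeff n ((subMatrix S P R : PowerSeries ℕ) * stateSeries R.1) ≤
      PowerSeries.coeff n (stateSeries P.1) := by
  rw [stateSeries_eq P.1, map_add, map_sum]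
  refine le_add_left ?_
  exact (Finset.sum_coe_sort S fun R =>
    PowerSeries.coeff n ((stepMatrix m P R : PowerSeries ℕ) * stateSeries R)).trans_le
    (Finset.sum_le_univ_sum_of_nonneg fun _ => Nat.zero_le _)

/-- The inhomogeneous term gives length `1`, and an edge of weight `x` inside `S` raises the length
by one. -/
theorem one_le_coeff_stateSeries {S : Finset (State m)}
    (hS : ∀ P : S, ∃ R : S, 1 ≤ (subMatrix S P R).coeff 1) (P : S) (n : ℕ) (hn : n ≠ 0) :
    1 ≤ PowerSeries.coeff n (stateSeries P.1) := by
  obtain ⟨n, rfl⟩ := Nat.exists_eq_succ_of_ne_zero hn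
  clear hn
  induction n generalizing P with
  | zero =>
    rw [stateSeries_eq P.1, map_add]
    exact le_add_right (by simp)
  | succ n ih =>
    obtain ⟨R, hR⟩ := hS P
    refine le_trans ?_ (sum_coeff_le S P _)
    refine le_trans ?_ (Finset.single_le_sum (fun _ _ => Nat.zero_le _) (Finset.mem_univ R))
    rw [PowerSeries.coeff_mul]
    refine le_trans ?_ (Finset.single_le_sum (fun _ _ => Nat.zero_le _)
      (Finset.HasAntidiagonal.mem_antidiagonal.2 (Nat.add_comm 1 n.succ) :
        (1, n.succ) ∈ Finset.HasAntidiagonal.antidiagonal n.succ.succ))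
    rw [Polynomial.coeff_coe]
    exact Nat.mul_pos hR (ih R)

theorem exists_le_count {S : Finset (State m)} (P : S)
    (hS : ∀ P : S, ∃ R : S, 1 ≤ (subMatrix S P R).coeff 1) {r : ℝ} {v : S → ℝ}
    (h : IsPerronPair (subMatrix S) r v) :
    ∃ c : ℝ, 0 < c ∧ ∀ n, n ≠ 0 → c * r⁻¹ ^ n ≤ count m n := by
  have : Nonempty S := ⟨P⟩
  obtain ⟨c, hc, hle⟩ := h.exists_le_coeff (fun _ _ => stepMatrix_coeff_zero _ _)
    (f := fun R => stateSeries R.1) (sum_coeff_le S) (one_le_coeff_stateSeries hS)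
  refine ⟨c * v P, mul_pos hc (h.vec_pos P), fun n hn => (hle P n hn).trans ?_⟩
  rw [count_eq_endCount m n hn, stateSeries, endSeries, PowerSeries.coeff_mk]
  exact_mod_cast endCount_mono m le_top le_top n

theorem exists_count_le {r s : ℝ} (hr : 0 < r)
    (hroots : ∀ z : ℂ, ‖z‖ < r → ¬ (denom m).IsRoot z) (hs : r⁻¹ < s) :
    ∃ K : ℝ, ∀ n, (count m n : ℝ) ≤ K * s ^ n := by
  obtain ⟨N, hN⟩ := exists_denom_mul_genFun m
  have hs0 : 0 < s := (inv_pos.2 hr).trans hs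
  obtain ⟨K, hK⟩ := exists_coeff_bound hs0 denom_ne_zero (fun α hα => by
    have h1 : r ≤ ‖α‖ := not_lt.1 fun h => hroots α h hα
    have h2 : 1 < r * s := by rwa [← inv_lt_iff_one_lt_mul₀' hr]
    exact h2.trans_le (mul_le_mul_of_nonneg_right h1 hs0.le)) hN
  refine ⟨K, fun n => ?_⟩
  simpa [genFun] using hK n

/-! ### Absence of kernel vectors on the components -/

theorem compU_kernel (hm : 1 ≤ m) {r : ℝ} {v : compU m → ℝ}
    (h : IsPerronPair (subMatrix (compU m)) r v) {z : ℂ} (hz : ‖z‖ ≤ r) (hne : z ≠ r)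
    (u : compU m → ℂ) (hu : ∀ P, ∑ R, aeval z (subMatrix (compU m) P R) * u R = u P) : u = 0 := by
  by_contra hu0
  obtain ⟨-, θ, hθ, hph⟩ := h.phases (stronglyConnected_compU hm) hz hu0 hu
  set l : Fin m := ⟨m - 1, by omega⟩ with hl
  set L : compU m := ⟨topState l, mem_compU.2 ⟨l, rfl⟩⟩ with hL
  have hloop : subMatrix (compU m) L L = X := topState_loop hm (by simp [hl]; omega)
  have h1 := hph L L
  rw [hloop, aeval_X, aeval_X] at h1
  exact hne (mul_right_cancel₀ (hθ L) h1)

/-- The cycles `a → b → a` and `a → b → c → a` have all weights `x`, so coherent phases give `z² =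
r²` and `z³ = r³`. The state `c` needs `m ≥ 3`. -/
theorem compV_kernel (hm : 3 ≤ m) {r : ℝ} {v : compV m → ℝ}
    (h : IsPerronPair (subMatrix (compV m)) r v) {z : ℂ} (hz : ‖z‖ ≤ r) (hne : z ≠ r)
    (u : compV m → ℂ) (hu : ∀ P, ∑ R, aeval z (subMatrix (compV m) P R) * u R = u P) : u = 0 := by
  by_contra hu0
  obtain ⟨-, θ, hθ, hph⟩ := h.phases (stronglyConnected_compV (by omega)) hz hu0 hu
  have hX : ∀ {P R : compV m}, subMatrix (compV m) P R = X → z * θ R = r * θ P := by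
    intro P R hPR
    simpa [hPR] using hph P R
  set a : compV m := vState (m - 1) (m - 2) (by omega) (by omega) (by omega) with ha
  set b : compV m := vState (m - 2) (m - 1) (by omega) (by omega) (by omega) with hb
  set c : compV m := vState (m - 3) (m - 1) (by omega) (by omega) (by omega) with hc
  have hab := hX (P := a) (R := b) (vState_last (by omega) (by omega))
  have hba := hX (P := b) (R := a) (vState_first (by omega) (by omega))
  have hbc := hX (P := b) (R := c) (vState_last (by omega) (by omega))
  have hca := hX (P := c) (R := a) (vState_first (by omega) (by omega))
  have hr : (r : ℂ) ≠ 0 := by exact_mod_cast h.pos.ne'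
  have h2 : z ^ 2 = (r : ℂ) ^ 2 := by
    refine mul_right_cancel₀ (hθ a) ?_
    linear_combination z * hba + r * hab
  have h3 : z ^ 3 = (r : ℂ) ^ 3 := by
    refine mul_right_cancel₀ (hθ a) ?_
    linear_combination z ^ 2 * hca + z * r * hbc + r ^ 2 * hab
  refine hne (mul_left_cancel₀ (pow_ne_zero 2 hr) ?_)
  rw [← h2, ← pow_succ, h3, h2]
  ring

/-- For `m = 2` the component is a bare 2-cycle with weights `x`, so `r² = 1`. -/
theorem compV_two_radius {r : ℝ} {v : compV 2 → ℝ}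
    (h : IsPerronPair (subMatrix (compV 2)) r v) : r = 1 := by
  set a : compV 2 := vState 1 0 (by omega) (by omega) (by omega) with ha
  set b : compV 2 := vState 0 1 (by omega) (by omega) (by omega) with hb
  have hall : ∀ P : compV 2, P = a ∨ P = b := by
    intro P
    obtain ⟨i, j, hi, hj, h, rfl⟩ := exists_vState P
    rcases h with h | ⟨h1, h2⟩
    · obtain rfl : i = 1 := by omega
      obtain rfl : j = 0 := by omega
      exact Or.inl rfl
    · obtain rfl : i = 0 := by omega
      obtain rfl : j = 1 := by omega
      exact Or.inr rfl
  have hab : subMatrix (compV 2) a b = X := vState_last (by omega) (by omega)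
  have hba : subMatrix (compV 2) b a = X := vState_first (by omega) (by omega)
  have hne : a ≠ b := by
    intro h0
    have h1 : ((1 : ℤ) : WithTop ℤ) = (0 : ℤ) := congrArg (fun P : compV 2 => P.1.1.val) h0
    exact one_ne_zero (WithTop.coe_inj.1 h1)
  have haa : subMatrix (compV 2) a a = 0 := by
    by_contra h0
    rcases stepMatrix_cases h0 with ⟨k, hk1, hkm, h1, h2⟩ | ⟨h1, h2⟩ <;>
      simp only [ha, vState, finState, Threshold.val_coe, shift_coe, coe_int_inj] at h1 h2 <;>
      omega
  have hbb : subMatrix (compV 2) b b = 0 := by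
    by_contra h0
    rcases stepMatrix_cases h0 with ⟨k, hk1, hkm, h1, h2⟩ | ⟨h1, h2⟩ <;>
      simp only [hb, vState, finState, Threshold.val_coe, shift_coe, coe_int_inj] at h1 h2 <;>
      omega
  have hsum : ∀ g : compV 2 → ℝ, ∑ R, g R = g a + g b := by
    intro g
    rw [← Finset.sum_pair hne]
    congr 1
    ext P
    simpa using hall P
  have h1 := h.eq a
  have h2 := h.eq b
  rw [hsum, haa, hab, map_zero, zero_mul, zero_add, aeval_X] at h1
  rw [hsum, hbb, hba, map_zero, zero_mul, add_zero, aeval_X] at h2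
  have hva := h.vec_pos a
  have hr := h.pos
  have h3 : r * r * v a = 1 * v a := by rw [mul_assoc, h2, h1, one_mul]
  have h4 := mul_right_cancel₀ hva.ne' h3
  nlinarith

theorem compU_radius_lt_one (hm : 2 ≤ m) {r : ℝ} {v : compU m → ℝ}
    (h : IsPerronPair (subMatrix (compU m)) r v) : r < 1 := by
  set l : Fin m := ⟨m - 1, by omega⟩ with hl
  have hl' : (l : ℕ) + 1 = m := by simp [hl]; omega
  set i : Fin m := ⟨0, by omega⟩ with hi
  refine h.lt_one (i := ⟨topState l, mem_compU.2 ⟨l, rfl⟩⟩) (j := ⟨topState i, mem_compU.2 ⟨i, rfl⟩⟩)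
    ?_ (topState_loop (by omega) hl') (topState_edge i hl')
  simp [topState, hl, hi]
  omega

theorem compU_out (hm : 1 ≤ m) (P : compU m) : ∃ R, 1 ≤ (subMatrix (compU m) P R).coeff 1 := by
  obtain ⟨P, hP⟩ := P
  obtain ⟨i, rfl⟩ := mem_compU.1 hP
  exact ⟨⟨topState ⟨m - 1, by omega⟩, mem_compU.2 ⟨_, rfl⟩⟩,
    topState_first hm i (by simp; omega)⟩

theorem compV_out (P : compV m) : ∃ R, 1 ≤ (subMatrix (compV m) P R).coeff 1 := by
  obtain ⟨R, hR⟩ := exists_edge_compV P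
  exact ⟨R, by simp [hR]⟩

/-! ### Component radii and the growth constants -/

theorem exists_compU_perronPair (hm : 1 ≤ m) : Nonempty (compU m) ∧
    ∃ r v, IsPerronPair (subMatrix (compU m)) r v := by
  have : Nonempty (compU m) := ⟨⟨topState ⟨0, hm⟩, mem_compU.2 ⟨_, rfl⟩⟩⟩
  exact ⟨this, (stronglyConnected_compU hm).exists_perronPair⟩

theorem exists_compV_perronPair (hm : 2 ≤ m) : Nonempty (compV m) ∧
    ∃ r v, IsPerronPair (subMatrix (compV m)) r v := by
  have : Nonempty (compV m) := ⟨vState 1 0 (by omega) (by omega) (by omega)⟩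
  exact ⟨this, (stronglyConnected_compV hm).exists_perronPair⟩

/-- In the disc of radius `min rU rV`, the denominator vanishes at most at the real radius. -/
theorem eq_min_of_isRoot (hm : 2 ≤ m) {rU rV : ℝ} {vU : compU m → ℝ} {vV : compV m → ℝ}
    (hU : IsPerronPair (subMatrix (compU m)) rU vU) (hV : IsPerronPair (subMatrix (compV m)) rV vV)
    {z : ℂ} (hz : ‖z‖ ≤ min rU rV) (hroot : (denom m).IsRoot z) : z = ((min rU rV : ℝ) : ℂ) := by
  by_contra hne
  obtain ⟨u, hu0, hu⟩ := exists_kernel_of_isRoot hroot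
  have hzU := hz.trans (min_le_left _ _)
  have hzV := hz.trans (min_le_right _ _)
  have hreal : ∀ r : ℝ, 0 < r → min rU rV ≤ r → z ≠ r := by
    rintro r hr hle rfl
    rw [Complex.norm_real, Real.norm_of_nonneg hr.le] at hz
    exact hne (congrArg _ (le_antisymm hz hle))
  have hz1 : z ≠ 1 := by
    exact_mod_cast hreal 1 one_pos ((min_le_left _ _).trans hU.le_one)
  refine hu0 (kernel_eq_zero hz1
    (compU_kernel (by omega) hU hzU (hreal rU hU.pos (min_le_left _ _))) ?_ hu)
  rcases Nat.lt_or_ge m 3 with h3 | h3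
  -- The period 2 of `V` does no harm here: a kernel vector on `V` needs `‖z‖ = r_V = 1`, while `‖z‖
  -- ≤ r_U < 1`.
  · obtain rfl : m = 2 := by omega
    intro w hw
    by_contra hw0
    obtain ⟨hzr, -⟩ := hV.phases (stronglyConnected_compV hm) hzV hw0 hw
    rw [compV_two_radius hV] at hzr
    have := compU_radius_lt_one hm hU
    linarith
  · exact compV_kernel h3 hV hzV (hreal rV hV.pos (min_le_right _ _))

/-- For `m = 1`, `V` is empty and `U` is one loop of weight `x`, so the radius is `1`. Excluding
zeros from the open unit disc suffices for the upper bound. -/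
theorem tendsto_count_one :
    Filter.Tendsto (fun n : ℕ => (count 1 n : ℝ) ^ ((1 : ℝ) / (n : ℝ)))
      Filter.atTop (nhds 1) := by
  obtain ⟨⟨P⟩, r, v, h⟩ := exists_compU_perronPair (m := 1) le_rfl
  have hall : ∀ R : compU 1, R = P := by
    rintro ⟨R, hR⟩
    obtain ⟨P, hP⟩ := P
    obtain ⟨i, rfl⟩ := mem_compU.1 hR
    obtain ⟨j, rfl⟩ := mem_compU.1 hP
    obtain rfl : i = j := Subsingleton.elim _ _
    rfl
  have hr : r = 1 := by
    have hX : subMatrix (compU 1) P P = X := by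
      obtain ⟨i, hi⟩ := mem_compU.1 P.2
      rw [subMatrix, Matrix.of_apply, hi]
      exact topState_loop le_rfl (by omega)
    have h1 := h.eq P
    rw [Finset.sum_eq_single P (fun R _ hR => absurd (hall R) hR) (by simp), hX, aeval_X] at h1
    refine mul_right_cancel₀ (h.vec_pos P).ne' ?_
    rw [h1, one_mul]
  subst hr
  obtain ⟨c, hc, hlow⟩ := exists_le_count P (compU_out le_rfl) h
  have hV : ∀ P : compV 1, False := by
    intro P
    obtain ⟨i, j, hi, hj, h, -⟩ := exists_vState P
    omega
  have hroots : ∀ z : ℂ, ‖z‖ < 1 → ¬ (denom 1).IsRoot z := by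
    intro z hz hroot
    have hz1 : z ≠ 1 := by
      rintro rfl
      simp at hz
    obtain ⟨u, hu0, hu⟩ := exists_kernel_of_isRoot hroot
    refine hu0 (kernel_eq_zero hz1 (compU_kernel le_rfl h hz.le (by simpa using hz1))
      (fun w _ => ?_) hu)
    ext P
    exact (hV P).elim
  have := tendsto_rpow_of_bounds one_pos hc hlow fun s hs => exists_count_le one_pos hroots hs
  simpa using this

theorem growth (hm : 2 ≤ m) : ∃ rU rV : ℝ,
    IsComponentRadius (compU m) rU ∧ IsComponentRadius (compV m) rV ∧
    Filter.Tendsto (fun n : ℕ => (count m n : ℝ) ^ ((1 : ℝ) / (n : ℝ)))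
      Filter.atTop (nhds (max rU⁻¹ rV⁻¹)) ∧
    max rU⁻¹ rV⁻¹ = (min rU rV)⁻¹ ∧
    radius (genFun m) = ENNReal.ofReal (min rU rV) ∧
    ∀ z : ℂ, IsDominantPole (genFun m) z ↔ z = ((min rU rV : ℝ) : ℂ) := by
  obtain ⟨⟨PU⟩, rU, vU, hU⟩ := exists_compU_perronPair (m := m) (by omega)
  obtain ⟨⟨PV⟩, rV, vV, hV⟩ := exists_compV_perronPair hm
  have : Nonempty (compU m) := ⟨PU⟩
  have : Nonempty (compV m) := ⟨PV⟩
  have hr : 0 < min rU rV := lt_min hU.pos hV.pos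
  have hmax : max rU⁻¹ rV⁻¹ = (min rU rV)⁻¹ := by
    rcases le_total rU rV with h | h
    · rw [min_eq_left h, max_eq_left (inv_anti₀ hU.pos h)]
    · rw [min_eq_right h, max_eq_right (inv_anti₀ hV.pos h)]
  obtain ⟨c, hc, hlow⟩ : ∃ c : ℝ, 0 < c ∧ ∀ n, n ≠ 0 → c * (min rU rV)⁻¹ ^ n ≤ count m n := by
    rcases le_total rU rV with h | h
    · rw [min_eq_left h]
      exact exists_le_count PU (compU_out (by omega)) hU
    · rw [min_eq_right h]
      exact exists_le_count PV compV_out hV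
  have hroots : ∀ z : ℂ, ‖z‖ ≤ min rU rV → (denom m).IsRoot z → z = ((min rU rV : ℝ) : ℂ) :=
    fun z => eq_min_of_isRoot hm hU hV
  have hup : ∀ s, (min rU rV)⁻¹ < s → ∃ K : ℝ, ∀ n, (count m n : ℝ) ≤ K * s ^ n := by
    refine fun s hs => exists_count_le hr (fun z hz hroot => ?_) hs
    rw [hroots z hz.le hroot, Complex.norm_real, Real.norm_of_nonneg hr.le] at hz
    exact lt_irrefl _ hz
  have hcoeff : ∀ n, ‖PowerSeries.coeff n (genFun m)‖ = count m n := by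
    intro n
    simp [genFun]
  have hrad : radius (genFun m) = ENNReal.ofReal (min rU rV) :=
    radius_eq_of_bounds hr hc (by simpa only [hcoeff] using hlow)
      (by simpa only [hcoeff] using hup)
  obtain ⟨N, hN⟩ := exists_denom_mul_genFun m
  exact ⟨rU, rV, isComponentRadius_of_perronPair hU, isComponentRadius_of_perronPair hV,
    hmax ▸ tendsto_rpow_of_bounds hr hc hlow hup, hmax, hrad,
    isDominantPole_iff hr hc (by simpa only [hcoeff] using hlow) denom_ne_zero hN hroots hrad⟩

end Main

end BoundedAvoid

theorem mainTheorem6 :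
    Filter.Tendsto (fun n : ℕ => (BoundedAvoid.count 1 n : ℝ) ^ ((1 : ℝ) / (n : ℝ)))
      Filter.atTop (nhds 1) ∧
    ∀ m : ℕ, 2 ≤ m →
      ∃ rU rV : ℝ,
        BoundedAvoid.IsComponentRadius (BoundedAvoid.compU m) rU ∧
        BoundedAvoid.IsComponentRadius (BoundedAvoid.compV m) rV ∧
        Filter.Tendsto (fun n : ℕ => (BoundedAvoid.count m n : ℝ) ^ ((1 : ℝ) / (n : ℝ)))
          Filter.atTop (nhds (max rU⁻¹ rV⁻¹)) ∧
        max rU⁻¹ rV⁻¹ = (min rU rV)⁻¹ ∧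
        BoundedAvoid.radius (BoundedAvoid.genFun m) = ENNReal.ofReal (min rU rV) ∧
        ∀ z : ℂ, BoundedAvoid.IsDominantPole (BoundedAvoid.genFun m) z ↔
          z = ((min rU rV : ℝ) : ℂ) :=
  ⟨BoundedAvoid.tendsto_count_one, fun _ hm => BoundedAvoid.growth hm⟩
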